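/- Let $n\ge 1$, $\tfrac12<s<1$, let $B_1$ be the open unit ball of $\mathbb R^n$, and for $x,y\in B_1$, $x\ne y$, let $$G(x,y)=\frac{\kappa(n,s)}{|x-y|^{n-2s}}\int_0^{\rho(x,y)}\frac{t^{s-1}}{(1+t)^{n/2}}\,dt,\qquad \rho(x,y)=\frac{(1-|x|^2)(1-|y|^2)}{|x-y|^2},\qquad \kappa(n,s)=\frac{\Gamma(n/2)}{2^{2s}\pi^{n/2}\Gamma(s)^2},$$ be the Green function of $(-\Delta)^s$ in $B_1$. Let $G*f(x)=\int_{B_1}f(y)G(x,y)\,dy$ for $x\in B_1$ and $G*f=0$ on $\mathbb R^n\setminus B_1$. With $\delta(x)=\operatorname{dist}(x,\mathbb R^n\setminus B_1)$ let $L^p_r(B_1)$ be the space of $f\in L^1_{\rm loc}(B_1)$ with $\|f\|_{L^p_r(B_1)}:=\|\delta^r f\|_{L^p(B_1)}<\infty$. Let $1-s\le r\le s$, $1\le p\le\infty$, $f\in L^p_r(B_1)$ and $u=G*f$ (the integral converges absolutely for a.e. $x\in B_1$). 1. If $p=1$, then for every $1\le q<\frac{n}{n-2s+1}$, $|\nabla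 u|\in L^q_r(B_1)$ and $\||\nabla u|\|_{L^q_r(B_1)}\le C\|f\|_{L^1_r(B_1)}$, with a constant $C>0$ depending only on $n,s,q$. 2. If $1<p<\frac{n}{2s-1}$, then $|\nabla u|\in L^{\frac{np}{n-(2s-1)p}}_r(B_1)$ and $\||\nabla u|\|_{L^{np/(n-(2s-1)p)}_r(B_1)}\le C\|f\|_{L^p_r(B_1)}$, with a constant $C>0$ depending only on $n,s,p$. 3. If $p>\frac{n}{2s-1}$ (including $p=\infty$), then $|\nabla u|\in L^\infty_r(B_1)$ and $\||\nabla u|\|_{L^\infty_r(B_1)}\le C\|f\|_{L^p_r(B_1)}$, with a constant $C>0$ depending only on $n,s,p$. Here $\nabla u$ is the weak gradient of $u$ in $B_1$; its existence, i.e. $u\in W^{1,1}_{\rm loc}(B_1)$, is part of each of the three assertions. Moreover, there is a constant $C>0$ depending only on $n,s$ such that for all $1-s\le r\le s$ and all $x\neq y$ in $B_1$ the function $G(\cdot,y)$ is differentiable at $x$ and $$|\nabla_xG(x,y)|\,(1-|x|)^r\le C\,\frac{(1-|y|)^r}{|x-y|^{n-2s+1}}.$$ -/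

import Mathlib

open MeasureTheory Metric Set
open scoped ENNReal NNReal ContDiff

noncomputable section

/-- The open unit ball `B₁` of `ℝⁿ` (Euclidean norm). -/
def unitBall (n : ℕ) : Set (EuclideanSpace ℝ (Fin n)) := Metric.ball 0 1

/-- `ρ(x,y) = (1 - |x|²)(1 - |y|²) / |x - y|²`. -/
def greenRho {n : ℕ} (x y : EuclideanSpace ℝ (Fin n)) : ℝ :=
  (1 - ‖x‖ ^ 2) * (1 - ‖y‖ ^ 2) / ‖x - y‖ ^ 2

/-- The normalizing constant `κ(n,s) = Γ(n/2) / (2^{2s} π^{n/2} Γ(s)²)`. -/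
def greenKappa (n : ℕ) (s : ℝ) : ℝ :=
  Real.Gamma ((n : ℝ) / 2) /
    ((2 : ℝ) ^ (2 * s) * Real.pi ^ ((n : ℝ) / 2) * Real.Gamma s ^ 2)

/-- Green's function of `(-Δ)^s` on the unit ball. -/
def greenFunction {n : ℕ} (s : ℝ) (x y : EuclideanSpace ℝ (Fin n)) : ℝ :=
  greenKappa n s / ‖x - y‖ ^ ((n : ℝ) - 2 * s) *
    ∫ t in (0 : ℝ)..greenRho x y, t ^ (s - 1) / (1 + t) ^ ((n : ℝ) / 2)

open Classical in
/-- Green's potential `G * f`: the integral of `f(y) G(x,y)` over `B₁` for `x ∈ B₁`,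
and `0` outside of `B₁`. -/
def greenPotential {n : ℕ} (s : ℝ) (f : EuclideanSpace ℝ (Fin n) → ℝ)
    (x : EuclideanSpace ℝ (Fin n)) : ℝ :=
  if x ∈ unitBall n then ∫ y in unitBall n, f y * greenFunction s x y else 0

/-- `‖f‖_{L^p_r(Ω)} = ‖δ^r f‖_{L^p(Ω)}` with `δ = dist(·, ℝⁿ \ Ω)`. -/
def weightedNorm {n : ℕ} (Ω : Set (EuclideanSpace ℝ (Fin n))) (p : ℝ≥0∞) (r : ℝ)
    (f : EuclideanSpace ℝ (Fin n) → ℝ) : ℝ≥0∞ :=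
  eLpNorm (fun x => infDist x Ωᶜ ^ r * f x) p (volume.restrict Ω)

/-- `f ∈ L^p_r(Ω)`: `f` is locally integrable in `Ω` and has finite weighted norm. -/
def MemWeightedLp {n : ℕ} (Ω : Set (EuclideanSpace ℝ (Fin n))) (p : ℝ≥0∞) (r : ℝ)
    (f : EuclideanSpace ℝ (Fin n) → ℝ) : Prop :=
  LocallyIntegrableOn f Ω volume ∧ weightedNorm Ω p r f < ⊤

/-- `u ∈ W^{1,1}_loc(Ω)` with weak gradient `g`: both are locally integrable in the open
set `Ω`, and integration by parts in every direction `v` holds against test functions. -/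
def HasWeakGradientOn {n : ℕ} (Ω : Set (EuclideanSpace ℝ (Fin n)))
    (u : EuclideanSpace ℝ (Fin n) → ℝ)
    (g : EuclideanSpace ℝ (Fin n) → EuclideanSpace ℝ (Fin n)) : Prop :=
  LocallyIntegrableOn u Ω volume ∧ LocallyIntegrableOn g Ω volume ∧
    ∀ φ : EuclideanSpace ℝ (Fin n) → ℝ, ContDiff ℝ ∞ φ → HasCompactSupport φ →
      tsupport φ ⊆ Ω → ∀ v : EuclideanSpace ℝ (Fin n),
        ∫ x in Ω, u x * fderiv ℝ φ x v = - ∫ x in Ω, inner ℝ (g x) v * φ x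

end

/-! ### Power integrals and the layer cake formula -/

/-! Everything rests on the pointwise bound `|∇ₓG(x,y)| δ(x)^r ≤ C δ(y)^r |x-y|^(-(n-(2s-1)))`. It
gives `δ^r |∇u| ≤ C I(δ^r f)`, where `I` is the Riesz potential of order `a = 2s-1 > 0` on the ball.
The three cases are then mapping properties of `I`: Hölder plus Tonelli for `p = 1`,
Hardy-Littlewood-Sobolev (through the maximal function and Hedberg's inequality) for `1 < p < n/a`,
and Hölder or the essential supremum for `p > n/a`.

For the pointwise bound, write `G = κ d^(s-n/2) Φ(A/d)` with `d = |x-y|²`, `A = (1-|x|²)(1-|y|²)`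
and `Φ` the incomplete beta integral `greenProfile`. The recurrence `greenProfile_recurrence` splits
the gradient into a radial term along `x - y`, containing the bounded profile of index `n/2+1`, and
a boundary term along `x`. Both are compared with powers of `δ(y)/δ(x)` by elementary inequalities;
the range `1-s ≤ r ≤ s` is what the boundary term needs.

The weak gradient of `u` is the integral of `f(y) ∇ₓG(x,y)`. To see this, replace `d` by `d + ε`,
which removes the singularity on the diagonal; integrate by parts for fixed `y`; let `ε → 0` by
dominated convergence, since the kernel bounds are uniform in `ε`; and integrate in `y` by Fubini.
-/

lemma lintegral_Ioo_rpow_sub_one {p : ℝ} (hp : 0 < p) {b : ℝ} (hb : 0 ≤ b) :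
    ∫⁻ t in Ioo 0 b, ENNReal.ofReal (t ^ (p - 1)) = ENNReal.ofReal (b ^ p / p) := by
  rcases hb.eq_or_lt with rfl | hb
  · simp [Real.zero_rpow hp.ne']
  rw [← ofReal_integral_eq_lintegral_ofReal]
  · rw [← integral_Ioc_eq_integral_Ioo, ← intervalIntegral.integral_of_le hb.le,
      integral_rpow (Or.inl (by linarith))]
    simp [Real.zero_rpow hp.ne']
  · exact (intervalIntegral.integrableOn_Ioo_rpow_iff hb).2 (by linarith)
  · filter_upwards [ae_restrict_mem measurableSet_Ioo] with t ht
    exact Real.rpow_nonneg ht.1.le _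

lemma lintegral_Ioi_rpow_neg_sub_one {b : ℝ} (hb : 0 < b) {c : ℝ} (hc : 0 < c) :
    ∫⁻ t in Ioi c, ENNReal.ofReal (t ^ (-b - 1)) = ENNReal.ofReal (c ^ (-b) / b) := by
  rw [← ofReal_integral_eq_lintegral_ofReal]
  · rw [integral_Ioi_rpow_of_lt (by linarith) hc]
    congr 1
    rw [sub_add_cancel, neg_div_neg_eq]
  · exact integrableOn_Ioi_rpow_of_lt (by linarith) hc
  · filter_upwards [ae_restrict_mem measurableSet_Ioi] with t ht
    exact Real.rpow_nonneg (hc.trans ht).le _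

lemma lintegral_Ioi_indicator_rpow_sub_one {p : ℝ} (hp : 0 < p) (u : ℝ≥0∞) :
    ∫⁻ t in Ioi (0 : ℝ), {t : ℝ | ENNReal.ofReal t < u}.indicator
      (fun t => ENNReal.ofReal (t ^ (p - 1))) t = ENNReal.ofReal p⁻¹ * u ^ p := by
  have hm : MeasurableSet {t : ℝ | ENNReal.ofReal t < u} :=
    measurableSet_lt ENNReal.measurable_ofReal measurable_const
  rw [lintegral_indicator hm, Measure.restrict_restrict hm]
  have key : ∀ v : ℝ≥0∞, v ≠ ⊤ → ∫⁻ t in Ioo 0 v.toReal, ENNReal.ofReal (t ^ (p - 1)) =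
      ENNReal.ofReal p⁻¹ * v ^ p := by
    intro v hv
    rw [lintegral_Ioo_rpow_sub_one hp ENNReal.toReal_nonneg, div_eq_inv_mul,
      ENNReal.ofReal_mul (by positivity),
      ← ENNReal.ofReal_rpow_of_nonneg ENNReal.toReal_nonneg hp.le, ENNReal.ofReal_toReal hv]
  have hset : ∀ v : ℝ≥0∞, v ≠ ⊤ →
      {t : ℝ | ENNReal.ofReal t < v} ∩ Ioi 0 = Ioo 0 v.toReal := by
    intro v hv
    ext t
    simp only [mem_inter_iff, mem_ofPred_eq, mem_Ioi, mem_Ioo]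
    constructor
    · rintro ⟨h, ht⟩
      exact ⟨ht, (ENNReal.ofReal_lt_iff_lt_toReal ht.le hv).1 h⟩
    · rintro ⟨ht, h⟩
      exact ⟨(ENNReal.ofReal_lt_iff_lt_toReal ht.le hv).2 h, ht⟩
  by_cases hu : u = ⊤
  · subst hu
    have h1 : ENNReal.ofReal p⁻¹ * (⊤ : ℝ≥0∞) ^ p = ⊤ := by
      rw [ENNReal.top_rpow_of_pos hp, ENNReal.mul_top]
      simpa using hp
    rw [h1]
    refine ENNReal.eq_top_of_forall_nnreal_le fun r => ?_
    -- Integrating only up to `(p * r) ^ p⁻¹` already gives exactly `r`.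
    have h2 := key (ENNReal.ofReal ((p * r) ^ p⁻¹)) ENNReal.ofReal_ne_top
    rw [← hset _ ENNReal.ofReal_ne_top,
      ENNReal.ofReal_rpow_of_nonneg (by positivity) hp.le,
      Real.rpow_inv_rpow (by positivity) hp.ne', ← ENNReal.ofReal_mul (by positivity),
      inv_mul_cancel_left₀ hp.ne', ENNReal.ofReal_coe_nnreal] at h2
    rw [← h2]
    apply lintegral_mono_set
    intro t ht
    exact ⟨ENNReal.ofReal_lt_top, ht.2⟩
  · rw [hset u hu, key u hu]

lemma lintegral_rpow_eq_lintegral_measure_lt {α : Type*} [MeasurableSpace α] (μ : Measure α)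
    [SFinite μ] {f : α → ℝ≥0∞} (hf : Measurable f) {p : ℝ} (hp : 0 < p) :
    ∫⁻ x, f x ^ p ∂μ = ENNReal.ofReal p *
      ∫⁻ t in Ioi (0 : ℝ), ENNReal.ofReal (t ^ (p - 1)) * μ {x | ENNReal.ofReal t < f x} := by
  have h1 : ∀ x, f x ^ p = ENNReal.ofReal p * ∫⁻ t in Ioi (0 : ℝ),
      {t : ℝ | ENNReal.ofReal t < f x}.indicator (fun t => ENNReal.ofReal (t ^ (p - 1))) t := by
    intro x
    rw [lintegral_Ioi_indicator_rpow_sub_one hp, ← mul_assoc, ← ENNReal.ofReal_mul hp.le,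
      mul_inv_cancel₀ hp.ne', ENNReal.ofReal_one, one_mul]
  have hS : MeasurableSet {z : α × ℝ | ENNReal.ofReal z.2 < f z.1} :=
    measurableSet_lt (by fun_prop) (by fun_prop)
  have hm : Measurable (fun z : α × ℝ =>
      {t : ℝ | ENNReal.ofReal t < f z.1}.indicator (fun t => ENNReal.ofReal (t ^ (p - 1))) z.2) := by
    have : Measurable ({z : α × ℝ | ENNReal.ofReal z.2 < f z.1}.indicator
        (fun z => ENNReal.ofReal (z.2 ^ (p - 1)))) :=
      (by fun_prop : Measurable fun z : α × ℝ => ENNReal.ofReal (z.2 ^ (p - 1))).indicator hS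
    exact this
  simp_rw [h1]
  rw [lintegral_const_mul _ (Measurable.lintegral_prod_right' hm),
    lintegral_lintegral_swap hm.aemeasurable]
  congr 1
  apply lintegral_congr
  intro t
  have h2 : MeasurableSet {x | ENNReal.ofReal t < f x} := measurableSet_lt measurable_const hf
  rw [← setLIntegral_const, ← lintegral_indicator h2]
  rfl

/-! ### The dyadic centred maximal function -/

section Maximal

variable {E : Type*} [NormedAddCommGroup E] [NormedSpace ℝ E] [FiniteDimensional ℝ E]
  [MeasurableSpace E] [BorelSpace E]

/-- The maximal function over centred balls with dyadic radii. -/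
noncomputable def dyadicMaximal (μ : Measure E) (f : E → ℝ≥0∞) (x : E) : ℝ≥0∞ :=
  ⨆ k : ℤ, ⨍⁻ y in ball x ((2 : ℝ) ^ k), f y ∂μ

variable (μ : Measure E) [μ.IsAddHaarMeasure]

lemma measurable_setLIntegral_ball {f : E → ℝ≥0∞} (hf : Measurable f) :
    Measurable fun z : E × ℝ => ∫⁻ y in ball z.1 z.2, f y ∂μ := by
  have hS : MeasurableSet {w : (E × ℝ) × E | dist w.2 w.1.1 < w.1.2} :=
    measurableSet_lt (by fun_prop) (by fun_prop)
  have hm : Measurable ({w : (E × ℝ) × E | dist w.2 w.1.1 < w.1.2}.indicator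
      (fun w => f w.2)) := (by fun_prop : Measurable fun w : (E × ℝ) × E => f w.2).indicator hS
  have := Measurable.lintegral_prod_right' (ν := μ) hm
  convert this using 2 with z
  rw [← lintegral_indicator measurableSet_ball]
  rfl

/-- Dyadic radii make this a countable supremum. The price is the factor lost in
`lintegral_ball_le_dyadicMaximal` by rounding a radius up to a power of two. -/
lemma measurable_dyadicMaximal {f : E → ℝ≥0∞} (hf : Measurable f) :
    Measurable (dyadicMaximal μ f) := by
  refine Measurable.iSup fun k => ?_
  simp_rw [setLAverage_eq]
  have h1 : ∀ x : E, μ (ball x ((2 : ℝ) ^ k)) = μ (ball 0 ((2 : ℝ) ^ k)) := fun x =>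
    Measure.addHaar_ball_center μ x _
  simp_rw [h1]
  refine Measurable.div_const ?_ _
  exact (measurable_setLIntegral_ball μ hf).comp
    (by fun_prop : Measurable fun x : E => (x, (2 : ℝ) ^ k))

omit [BorelSpace E] in
-- Averages of the part of `f` below `c` never exceed `c`, so the weak-type bound need only be
-- applied to the part above `c`.
lemma dyadicMaximal_le_add {f : E → ℝ≥0∞} (hf : Measurable f) (c : ℝ≥0∞) (x : E) :
    dyadicMaximal μ f x ≤ dyadicMaximal μ ({y | c < f y}.indicator f) x + c := by
  refine iSup_le fun k => ?_
  have hS : MeasurableSet {y | c < f y} := measurableSet_lt measurable_const hf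
  calc ⨍⁻ y in ball x ((2 : ℝ) ^ k), f y ∂μ
      ≤ ⨍⁻ y in ball x ((2 : ℝ) ^ k), ({y | c < f y}.indicator f y + c) ∂μ := by
        refine lintegral_mono fun y => ?_
        by_cases hy : c < f y
        · simp [indicator, hy]
        · rw [indicator_of_notMem (by exact hy), zero_add]
          exact not_lt.1 hy
    _ = (⨍⁻ y in ball x ((2 : ℝ) ^ k), {y | c < f y}.indicator f y ∂μ) + c := by
        simp_rw [setLAverage_eq]
        rw [lintegral_add_right _ measurable_const, ENNReal.add_div, setLIntegral_const,
          ENNReal.mul_div_cancel_right (measure_ball_pos μ x (by positivity)).ne'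
            measure_ball_lt_top.ne]
    _ ≤ _ := by
        gcongr
        exact le_iSup (fun k : ℤ => ⨍⁻ y in ball x ((2 : ℝ) ^ k), {y | c < f y}.indicator f y ∂μ) k

variable [Nontrivial E]

/-- Vitali covering: among the balls on which the average of `f` exceeds `c`, a disjoint subfamily
has fivefold enlargements covering the level set. -/
lemma measure_lt_dyadicMaximal_le (f : E → ℝ≥0∞) (c : ℝ≥0∞) :
    c * μ {x | c < dyadicMaximal μ f x} ≤
      ENNReal.ofReal (5 ^ Module.finrank ℝ E) * ∫⁻ y, f y ∂μ := by
  by_cases hI : ∫⁻ y, f y ∂μ = ⊤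
  · rw [hI, ENNReal.mul_top (by positivity)]
    exact le_top
  set S := {x | c < dyadicMaximal μ f x} with hSdef
  by_cases hc0 : c = 0
  · simp [hc0]
  have hex : ∀ x, ∃ k : ℤ, x ∈ S →
      c * μ (ball x ((2 : ℝ) ^ k)) ≤ ∫⁻ y in ball x ((2 : ℝ) ^ k), f y ∂μ := by
    intro x
    by_cases hx : x ∈ S
    · obtain ⟨k, hk⟩ := lt_iSup_iff.1 (show c < ⨆ k : ℤ, _ from hx)
      refine ⟨k, fun _ => ?_⟩
      rw [setLAverage_eq] at hk
      have hpos : 0 < μ (ball x ((2 : ℝ) ^ k)) := measure_ball_pos μ x (by positivity)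
      exact (ENNReal.le_div_iff_mul_le (Or.inl hpos.ne')
        (Or.inl measure_ball_lt_top.ne)).1 hk.le
    · exact ⟨0, fun h => absurd h hx⟩
  choose k hk using hex
  by_cases hct : c = ⊤
  · have : S = ∅ := by
      ext x; simp [hSdef, hct]
    simp [this]
  have hB : 0 < μ (ball (0 : E) 1) := measure_ball_pos μ 0 one_pos
  have hBt : μ (ball (0 : E) 1) ≠ ⊤ := measure_ball_lt_top.ne
  have hd : Module.finrank ℝ E ≠ 0 := Module.finrank_pos.ne'
  set A : ℝ≥0∞ := (∫⁻ y, f y ∂μ) / (c * μ (ball (0 : E) 1)) with hA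
  have hcB : c * μ (ball (0 : E) 1) ≠ 0 := mul_ne_zero hc0 hB.ne'
  have hcBt : c * μ (ball (0 : E) 1) ≠ ⊤ := ENNReal.mul_ne_top hct hBt
  have hAt : A ≠ ⊤ := ENNReal.div_ne_top hI hcB
  -- Vitali needs bounded radii. A radius `R` chosen here has `c R^d |B₁| ≤ ∫ f`, and `R ≤ R^d` once
  -- `R ≥ 1`.
  have hR : ∀ x ∈ S, (2 : ℝ) ^ k x ≤ max 1 A.toReal := by
    intro x hx
    by_cases h1 : (2 : ℝ) ^ k x ≤ 1
    · exact le_max_of_le_left h1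
    · push Not at h1
      apply le_max_of_le_right
      refine (le_self_pow₀ h1.le hd).trans ?_
      rw [← ENNReal.ofReal_le_iff_le_toReal hAt, hA, ENNReal.le_div_iff_mul_le (Or.inl hcB) (Or.inl hcBt)]
      have h2 := hk x hx
      rw [Measure.addHaar_ball μ x (by positivity)] at h2
      calc _ = c * (ENNReal.ofReal (((2 : ℝ) ^ k x) ^ Module.finrank ℝ E) * μ (ball 0 1)) := by ring
        _ ≤ _ := h2
        _ ≤ _ := setLIntegral_le_lintegral _ _
  obtain ⟨u, huS, hdisj, hcov⟩ := Vitali.exists_disjoint_subfamily_covering_enlargement_closedBall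
    S (fun x => x) (fun x => (2 : ℝ) ^ k x) _ hR 5 (by norm_num)
  have hucount : u.Countable := hdisj.countable_of_nonempty_interior fun x _ => by
    refine ⟨x, ball_subset_interior_closedBall (mem_ball_self (by positivity))⟩
  have hdisj' : u.PairwiseDisjoint fun x => ball x ((2 : ℝ) ^ k x) :=
    hdisj.mono fun x => ball_subset_closedBall
  have hsub : S ⊆ ⋃ b ∈ u, closedBall b (5 * (2 : ℝ) ^ k b) := by
    intro x hx
    obtain ⟨b, hb, hxb⟩ := hcov x hx
    exact mem_biUnion hb (hxb (mem_closedBall_self (by positivity)))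
  calc c * μ S ≤ c * ∑' b : u, μ (closedBall (b : E) (5 * (2 : ℝ) ^ k b)) := by
        gcongr
        exact (measure_mono hsub).trans (measure_biUnion_le μ hucount _)
    _ = ∑' b : u, c * μ (closedBall (b : E) (5 * (2 : ℝ) ^ k b)) := ENNReal.tsum_mul_left.symm
    _ ≤ ∑' b : u, ENNReal.ofReal (5 ^ Module.finrank ℝ E) *
          ∫⁻ y in ball (b : E) ((2 : ℝ) ^ k b), f y ∂μ := by
        refine ENNReal.tsum_le_tsum fun b => ?_
        rw [Measure.addHaar_closedBall μ _ (by positivity), mul_pow,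
          ENNReal.ofReal_mul (by positivity)]
        have h2 := hk b (huS b.2)
        rw [Measure.addHaar_ball μ _ (by positivity)] at h2
        calc _ = ENNReal.ofReal (5 ^ Module.finrank ℝ E) *
              (c * (ENNReal.ofReal (((2 : ℝ) ^ k b) ^ Module.finrank ℝ E) * μ (ball 0 1))) := by ring
          _ ≤ _ := by gcongr
    _ = ENNReal.ofReal (5 ^ Module.finrank ℝ E) *
          ∫⁻ y in ⋃ b ∈ u, ball b ((2 : ℝ) ^ k b), f y ∂μ := by
        rw [ENNReal.tsum_mul_left, lintegral_biUnion hucount (fun _ _ => measurableSet_ball) hdisj']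
    _ ≤ _ := by
        gcongr
        exact Measure.restrict_le_self

/-- The Hardy-Littlewood maximal inequality. -/
lemma lintegral_dyadicMaximal_rpow_le {p : ℝ} (hp : 1 < p) :
    ∃ C : ℝ≥0∞, C ≠ ⊤ ∧ ∀ f : E → ℝ≥0∞, Measurable f →
      ∫⁻ x, dyadicMaximal μ f x ^ p ∂μ ≤ C * ∫⁻ x, f x ^ p ∂μ := by
  set D := ENNReal.ofReal (5 ^ Module.finrank ℝ E)
  refine ⟨ENNReal.ofReal p * (2 * D * (ENNReal.ofReal (p - 1)⁻¹ * 2 ^ (p - 1))), ?_, ?_⟩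
  · finiteness
  intro f hf
  have hp0 : 0 < p := by linarith
  have hS : ∀ t : ℝ, MeasurableSet {y | ENNReal.ofReal t < 2 * f y} := fun t =>
    measurableSet_lt measurable_const (by fun_prop)
  -- The part of `f` below `t/2` contributes at most `t/2` to the maximal function, so the part
  -- above `t/2` must account for the rest; the weak-type bound is used for it at height `t/2`.
  have weak : ∀ t ∈ Ioi (0 : ℝ), μ {x | ENNReal.ofReal t < dyadicMaximal μ f x} ≤
      2 * D * (ENNReal.ofReal t⁻¹ *
        ∫⁻ y, {y | ENNReal.ofReal t < 2 * f y}.indicator f y ∂μ) := by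
    intro t ht
    have ht : 0 < t := ht
    have hset : {y | ENNReal.ofReal (t / 2) < f y} = {y | ENNReal.ofReal t < 2 * f y} := by
      ext y
      simp only [mem_ofPred_eq]
      rw [ENNReal.ofReal_div_of_pos two_pos, ENNReal.ofReal_ofNat,
        ENNReal.div_lt_iff (Or.inl two_ne_zero) (Or.inl ENNReal.ofNat_ne_top), mul_comm]
    have h1 : {x | ENNReal.ofReal t < dyadicMaximal μ f x} ⊆
        {x | ENNReal.ofReal (t / 2) <
          dyadicMaximal μ ({y | ENNReal.ofReal (t / 2) < f y}.indicator f) x} := by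
      intro x hx
      by_contra hcon
      simp only [mem_ofPred_eq, not_lt] at hcon hx
      have h2 := (dyadicMaximal_le_add μ hf (ENNReal.ofReal (t / 2)) x).trans
        (add_le_add_left hcon _)
      rw [← ENNReal.ofReal_add (by positivity) (by positivity), add_halves] at h2
      exact absurd hx (not_lt.2 h2)
    have h3 := measure_lt_dyadicMaximal_le μ
      ({y | ENNReal.ofReal (t / 2) < f y}.indicator f) (ENNReal.ofReal (t / 2))
    rw [hset] at h3 h1
    have h4 : (2 * ENNReal.ofReal t⁻¹) * ENNReal.ofReal (t / 2) = 1 := by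
      rw [← ENNReal.ofReal_ofNat, ← ENNReal.ofReal_mul (by positivity),
        ← ENNReal.ofReal_mul (by positivity), ← ENNReal.ofReal_one]
      congr 1
      field_simp
    calc μ {x | ENNReal.ofReal t < dyadicMaximal μ f x}
        ≤ _ := measure_mono h1
      _ = (2 * ENNReal.ofReal t⁻¹) * (ENNReal.ofReal (t / 2) * μ {x | ENNReal.ofReal (t / 2) <
          dyadicMaximal μ ({y | ENNReal.ofReal t < 2 * f y}.indicator f) x}) := by
          rw [← mul_assoc, h4, one_mul]
      _ ≤ (2 * ENNReal.ofReal t⁻¹) *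
          (D * ∫⁻ y, {y | ENNReal.ofReal t < 2 * f y}.indicator f y ∂μ) := by gcongr
      _ = _ := by ring
  have hmS : MeasurableSet {z : ℝ × E | ENNReal.ofReal z.1 < 2 * f z.2} :=
    measurableSet_lt (by fun_prop) (by fun_prop)
  have hm : Measurable (fun z : ℝ × E => ENNReal.ofReal (z.1 ^ (p - 1 - 1)) *
      {y | ENNReal.ofReal z.1 < 2 * f y}.indicator f z.2) := by
    have : Measurable ({z : ℝ × E | ENNReal.ofReal z.1 < 2 * f z.2}.indicator
        (fun z => f z.2)) := (by fun_prop : Measurable fun z : ℝ × E => f z.2).indicator hmS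
    exact (by fun_prop : Measurable fun z : ℝ × E => ENNReal.ofReal (z.1 ^ (p - 1 - 1))).mul this
  rw [lintegral_rpow_eq_lintegral_measure_lt μ (measurable_dyadicMaximal μ hf) hp0, mul_assoc]
  gcongr
  calc ∫⁻ t in Ioi (0 : ℝ), ENNReal.ofReal (t ^ (p - 1)) *
        μ {x | ENNReal.ofReal t < dyadicMaximal μ f x}
      ≤ ∫⁻ t in Ioi (0 : ℝ), 2 * D * ∫⁻ y, ENNReal.ofReal (t ^ (p - 1 - 1)) *
          {y | ENNReal.ofReal t < 2 * f y}.indicator f y ∂μ := by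
        refine setLIntegral_mono' measurableSet_Ioi fun t ht => ?_
        have ht0 : 0 < t := ht
        rw [lintegral_const_mul _ (hf.indicator (hS t))]
        refine (mul_le_mul_right (weak t ht) _).trans (le_of_eq ?_)
        have : ENNReal.ofReal (t ^ (p - 1 - 1)) = ENNReal.ofReal (t ^ (p - 1)) * ENNReal.ofReal t⁻¹ := by
          rw [← ENNReal.ofReal_mul (by positivity), Real.rpow_sub_one ht0.ne', div_eq_mul_inv]
        rw [this]
        ring
    _ = 2 * D * ∫⁻ y, (∫⁻ t in Ioi (0 : ℝ), ENNReal.ofReal (t ^ (p - 1 - 1)) *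
          {y | ENNReal.ofReal t < 2 * f y}.indicator f y) ∂μ := by
        rw [lintegral_const_mul _ (Measurable.lintegral_prod_right' hm),
          lintegral_lintegral_swap hm.aemeasurable]
    -- For fixed `y` the variable `t` runs up to `2 f y`, and `t^(p-2)` is integrable at 0 because
    -- `p > 1`.
    _ = 2 * D * ∫⁻ y, ENNReal.ofReal (p - 1)⁻¹ * 2 ^ (p - 1) * f y ^ p ∂μ := by
        congr 1
        refine lintegral_congr fun y => ?_
        have h5 : ∀ t : ℝ, ENNReal.ofReal (t ^ (p - 1 - 1)) *
            {y | ENNReal.ofReal t < 2 * f y}.indicator f y =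
            {t : ℝ | ENNReal.ofReal t < 2 * f y}.indicator
              (fun t => ENNReal.ofReal (t ^ (p - 1 - 1))) t * f y := by
          intro t
          simp only [indicator, mem_ofPred_eq]
          split_ifs <;> simp
        simp_rw [h5]
        rw [lintegral_mul_const _ ((by fun_prop : Measurable fun t : ℝ =>
            ENNReal.ofReal (t ^ (p - 1 - 1))).indicator
            (measurableSet_lt ENNReal.measurable_ofReal measurable_const)),
          lintegral_Ioi_indicator_rpow_sub_one (by linarith),
          ENNReal.mul_rpow_of_nonneg _ _ (by linarith)]
        have h6 : f y ^ p = f y ^ (p - 1) * f y := by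
          conv_rhs => rw [← ENNReal.rpow_one (f y), ← ENNReal.rpow_mul, one_mul]
          rw [← ENNReal.rpow_add_of_nonneg _ _ (by linarith) zero_le_one, sub_add_cancel]
        rw [h6]
        ring
    _ = _ := by
        rw [lintegral_const_mul _ (by fun_prop)]
        ring

end Maximal

/-! ### Riesz potentials -/

/-- Equality holds for `c > 0`. At `c = 0` the convention `0 ^ (-b) = 0` makes the left side vanish
while the integral diverges, hence only `≤`. -/
lemma ofReal_rpow_neg_le_lintegral {b : ℝ} (hb : 0 < b) {c : ℝ} (hc : 0 ≤ c) :
    ENNReal.ofReal (c ^ (-b)) ≤ ENNReal.ofReal b * ∫⁻ t in Ioi (0 : ℝ),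
      (Ioi c).indicator (fun t => ENNReal.ofReal (t ^ (-b - 1))) t := by
  rcases hc.eq_or_lt with rfl | hc
  · simp [Real.zero_rpow (neg_ne_zero.2 hb.ne')]
  rw [lintegral_indicator measurableSet_Ioi, Measure.restrict_restrict measurableSet_Ioi,
    inter_eq_left.2 (Ioi_subset_Ioi hc.le), lintegral_Ioi_rpow_neg_sub_one hb hc,
    ← ENNReal.ofReal_mul hb.le, mul_div_cancel₀ _ hb.ne']

section Riesz

variable {E : Type*} [NormedAddCommGroup E] [NormedSpace ℝ E] [FiniteDimensional ℝ E]
  [MeasurableSpace E] [BorelSpace E]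

/-- The potential of `f` with kernel `|x - y|^(-b)`. -/
noncomputable def rieszPotential (μ : Measure E) (b : ℝ) (f : E → ℝ≥0∞) (x : E) : ℝ≥0∞ :=
  ∫⁻ y, f y * ENNReal.ofReal (‖x - y‖ ^ (-b)) ∂μ

variable (μ : Measure E) [μ.IsAddHaarMeasure]

/-- The kernel is a superposition of indicators of balls around `x`, so bounds on the masses of `f`
in these balls control the potential. -/
lemma rieszPotential_le_lintegral_ball {b : ℝ} (hb : 0 < b) {f : E → ℝ≥0∞} (hf : Measurable f)
    (x : E) :
    rieszPotential μ b f x ≤ ENNReal.ofReal b * ∫⁻ t in Ioi (0 : ℝ),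
      ENNReal.ofReal (t ^ (-b - 1)) * ∫⁻ y in ball x t, f y ∂μ := by
  have hS : MeasurableSet {z : E × ℝ | ‖x - z.1‖ < z.2} := measurableSet_lt (by fun_prop) (by fun_prop)
  have hm0 : Measurable (fun z : E × ℝ =>
      {t : ℝ | ‖x - z.1‖ < t}.indicator (fun t => ENNReal.ofReal (t ^ (-b - 1))) z.2) := by
    have : Measurable ({z : E × ℝ | ‖x - z.1‖ < z.2}.indicator
        (fun z => ENNReal.ofReal (z.2 ^ (-b - 1)))) :=
      (by fun_prop : Measurable fun z : E × ℝ => ENNReal.ofReal (z.2 ^ (-b - 1))).indicator hS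
    exact this
  have hm : Measurable (fun z : E × ℝ => f z.1 *
      {t : ℝ | ‖x - z.1‖ < t}.indicator (fun t => ENNReal.ofReal (t ^ (-b - 1))) z.2) :=
    (by fun_prop : Measurable fun z : E × ℝ => f z.1).mul hm0
  calc rieszPotential μ b f x
      ≤ ∫⁻ y, ENNReal.ofReal b * (∫⁻ t in Ioi (0 : ℝ), f y *
          {t : ℝ | ‖x - y‖ < t}.indicator (fun t => ENNReal.ofReal (t ^ (-b - 1))) t) ∂μ := by
        refine lintegral_mono fun y => ?_
        have hy : Measurable ({t : ℝ | ‖x - y‖ < t}.indicator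
            (fun t => ENNReal.ofReal (t ^ (-b - 1)))) :=
          hm0.comp (by fun_prop : Measurable fun t : ℝ => (y, t))
        dsimp only
        rw [lintegral_const_mul _ hy, mul_left_comm]
        gcongr
        exact ofReal_rpow_neg_le_lintegral hb (norm_nonneg _)
    _ = _ := by
        rw [lintegral_const_mul _ (Measurable.lintegral_prod_right' hm),
          lintegral_lintegral_swap hm.aemeasurable]
        congr 1
        refine lintegral_congr fun t => ?_
        rw [← lintegral_indicator measurableSet_ball,
          ← lintegral_const_mul _ (hf.indicator measurableSet_ball)]
        refine lintegral_congr fun y => ?_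
        simp only [indicator, mem_ofPred_eq, mem_ball, dist_comm y x, dist_eq_norm]
        split_ifs <;> simp [mul_comm]

variable [Nontrivial E]

lemma lintegral_ball_le_dyadicMaximal (f : E → ℝ≥0∞) (x : E) {t : ℝ} (ht : 0 < t) :
    ∫⁻ y in ball x t, f y ∂μ ≤ ENNReal.ofReal ((2 * t) ^ Module.finrank ℝ E) *
      μ (ball (0 : E) 1) * dyadicMaximal μ f x := by
  obtain ⟨k, hk1, hk2⟩ := exists_mem_Ioc_zpow ht (one_lt_two : (1 : ℝ) < 2)
  have h2 : (2 : ℝ) ^ (k + 1) ≤ 2 * t := by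
    rw [zpow_add_one₀ two_ne_zero]; linarith
  have hpos := measure_ball_pos μ x (show (0 : ℝ) < 2 ^ (k + 1) by positivity)
  calc ∫⁻ y in ball x t, f y ∂μ ≤ ∫⁻ y in ball x (2 ^ (k + 1)), f y ∂μ :=
        lintegral_mono_set (ball_subset_ball hk2)
    _ = μ (ball x (2 ^ (k + 1))) * ⨍⁻ y in ball x (2 ^ (k + 1)), f y ∂μ := by
        rw [setLAverage_eq, ENNReal.mul_div_cancel hpos.ne' measure_ball_lt_top.ne]
    _ ≤ μ (ball x (2 * t)) * dyadicMaximal μ f x := by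
        gcongr
        exact le_iSup (fun k : ℤ => ⨍⁻ y in ball x ((2 : ℝ) ^ k), f y ∂μ) (k + 1)
    _ = _ := by rw [Measure.addHaar_ball μ x (by positivity)]

lemma lintegral_ball_le_rpow {p : ℝ} (hp : 1 < p) {f : E → ℝ≥0∞} (hf : Measurable f) (x : E)
    {t : ℝ} (ht : 0 < t) :
    ∫⁻ y in ball x t, f y ∂μ ≤ (∫⁻ y, f y ^ p ∂μ) ^ (1 / p) *
      (ENNReal.ofReal (t ^ Module.finrank ℝ E) * μ (ball (0 : E) 1)) ^ (1 - 1 / p) := by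
  have hpq : p.HolderConjugate p.conjExponent := Real.HolderConjugate.conjExponent hp
  have h := ENNReal.lintegral_mul_le_Lp_mul_Lq (μ.restrict (ball x t)) hpq
    hf.aemeasurable (aemeasurable_const (b := (1 : ℝ≥0∞)))
  simp only [Pi.mul_apply, mul_one, ENNReal.one_rpow, lintegral_one, Measure.restrict_apply_univ,
    Measure.addHaar_ball μ x ht.le] at h
  have h2 : 1 / p.conjExponent = 1 - 1 / p := by
    have := hpq.inv_add_inv_eq_one
    simp only [one_div]; linarith
  rw [h2] at h
  refine h.trans ?_
  gcongr
  exact Measure.restrict_le_self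

/-- The ball masses are estimated by the maximal function for `t ≤ R`, leaving `t^(a-1)`, and by
Hölder for `t > R`, leaving `t^(-(d/p-a)-1)`. The first is integrable at 0 because `a > 0`, the
second at infinity because `a p < d`. -/
lemma rieszPotential_le_add {a p : ℝ} (ha : 0 < a) (hp : 1 < p)
    (hap : a * p < Module.finrank ℝ E) :
    ∃ A : ℝ≥0∞, A ≠ ⊤ ∧ ∀ f : E → ℝ≥0∞, Measurable f → ∀ x : E, ∀ R : ℝ, 0 < R →
      rieszPotential μ (Module.finrank ℝ E - a) f x ≤ A * (dyadicMaximal μ f x * ENNReal.ofReal (R ^ a)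
        + (∫⁻ y, f y ^ p ∂μ) ^ (1 / p) * ENNReal.ofReal (R ^ (-(Module.finrank ℝ E / p - a)))) := by
  set d := Module.finrank ℝ E with hd
  have hp0 : 0 < p := by linarith
  have had : a < d := lt_of_le_of_lt (by nlinarith) hap
  have hb : 0 < (d : ℝ) - a := by linarith
  have hg : 0 < d / p - a := by rw [sub_pos, lt_div_iff₀ hp0]; exact hap
  set w := μ (ball (0 : E) 1)
  have hw : w ≠ ⊤ := measure_ball_lt_top.ne
  set A1 := ENNReal.ofReal (2 ^ d) * w * ENNReal.ofReal a⁻¹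
  set A2 := w ^ (1 - 1 / p) * ENNReal.ofReal (d / p - a)⁻¹
  have hpp : 0 ≤ 1 - 1 / p := by
    rw [sub_nonneg, div_le_one hp0]; exact hp.le
  have hA2 : A2 ≠ ⊤ := by
    refine ENNReal.mul_ne_top ?_ ENNReal.ofReal_ne_top
    exact ENNReal.rpow_ne_top_of_nonneg hpp hw
  refine ⟨ENNReal.ofReal (d - a) * (A1 + A2), by finiteness, ?_⟩
  intro f hf x R hR
  set M := dyadicMaximal μ f x
  set N := (∫⁻ y, f y ^ p ∂μ) ^ (1 / p)
  refine (rieszPotential_le_lintegral_ball μ hb hf x).trans ?_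
  rw [mul_assoc]
  gcongr
  rw [← Ioc_union_Ioi_eq_Ioi hR.le]
  refine (lintegral_union_le _ _ _).trans ?_
  have h1 : ∫⁻ t in Ioc 0 R, ENNReal.ofReal (t ^ (-((d : ℝ) - a) - 1)) * ∫⁻ y in ball x t, f y ∂μ ≤
      A1 * (M * ENNReal.ofReal (R ^ a)) := by
    calc _ ≤ ∫⁻ t in Ioc 0 R, ENNReal.ofReal (2 ^ d) * w * M * ENNReal.ofReal (t ^ (a - 1)) := by
          refine setLIntegral_mono' measurableSet_Ioc fun t ht => ?_
          refine (mul_le_mul_right (lintegral_ball_le_dyadicMaximal μ f x ht.1) _).trans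
            (le_of_eq ?_)
          have : ENNReal.ofReal (t ^ (a - 1)) =
              ENNReal.ofReal (t ^ (-((d : ℝ) - a) - 1)) * ENNReal.ofReal (t ^ d) := by
            rw [← ENNReal.ofReal_mul (Real.rpow_nonneg ht.1.le _), ← Real.rpow_natCast,
              ← Real.rpow_add ht.1]
            congr 2; ring
          rw [this, mul_pow, ENNReal.ofReal_mul (by positivity)]
          ring
      _ = A1 * (M * ENNReal.ofReal (R ^ a)) := by
          rw [lintegral_const_mul _ (by fun_prop), setLIntegral_congr Ioo_ae_eq_Ioc.symm,
            lintegral_Ioo_rpow_sub_one ha hR.le, div_eq_inv_mul, ENNReal.ofReal_mul (by positivity)]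
          ring
  have h2 : ∫⁻ t in Ioi R, ENNReal.ofReal (t ^ (-((d : ℝ) - a) - 1)) * ∫⁻ y in ball x t, f y ∂μ ≤
      A2 * (N * ENNReal.ofReal (R ^ (-(d / p - a)))) := by
    calc _ ≤ ∫⁻ t in Ioi R, N * w ^ (1 - 1 / p) * ENNReal.ofReal (t ^ (-(d / p - a) - 1)) := by
          refine setLIntegral_mono' measurableSet_Ioi fun t ht => ?_
          have ht0 : 0 < t := hR.trans ht
          refine (mul_le_mul_right (lintegral_ball_le_rpow μ hp hf x ht0) _).trans
            (le_of_eq ?_)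
          have : ENNReal.ofReal (t ^ (-(d / p - a) - 1)) =
              ENNReal.ofReal (t ^ (-((d : ℝ) - a) - 1)) * ENNReal.ofReal (t ^ d) ^ (1 - 1 / p) := by
            rw [ENNReal.ofReal_rpow_of_nonneg (by positivity) hpp,
              ← ENNReal.ofReal_mul (Real.rpow_nonneg ht0.le _), ← Real.rpow_natCast,
              ← Real.rpow_mul ht0.le, ← Real.rpow_add ht0]
            congr 2; ring
          rw [this, ENNReal.mul_rpow_of_nonneg _ _ hpp]
          ring
      _ = _ := by
          rw [lintegral_const_mul _ (by fun_prop), lintegral_Ioi_rpow_neg_sub_one hg hR,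
            div_eq_inv_mul (R ^ _), ENNReal.ofReal_mul (by positivity)]
          ring
  calc _ ≤ A1 * (M * ENNReal.ofReal (R ^ a)) + A2 * (N * ENNReal.ofReal (R ^ (-(d / p - a)))) :=
        add_le_add h1 h2
    _ ≤ (A1 + A2) * (M * ENNReal.ofReal (R ^ a)) +
        (A1 + A2) * (N * ENNReal.ofReal (R ^ (-(d / p - a)))) := by
        gcongr
        · exact le_self_add
        · exact le_add_self
    _ = _ := by rw [mul_add]

lemma ae_eq_zero_of_dyadicMaximal_eq_zero {f : E → ℝ≥0∞} (hf : Measurable f) {x : E}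
    (h : dyadicMaximal μ f x = 0) : ∫⁻ y, f y ∂μ = 0 := by
  have h1 : ∀ k : ℕ, ∫⁻ y in ball x (k + 1 : ℝ), f y ∂μ = 0 := fun k => by
    have := lintegral_ball_le_dyadicMaximal μ f x (show (0 : ℝ) < k + 1 by positivity)
    simpa [h] using this
  rw [lintegral_eq_zero_iff hf]
  have h2 : ∀ k : ℕ, ∀ᵐ y ∂μ, y ∈ ball x (k + 1 : ℝ) → f y = 0 := fun k => by
    have := (lintegral_eq_zero_iff hf).1 (h1 k)
    exact (ae_restrict_iff' measurableSet_ball).1 this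
  filter_upwards [ae_all_iff.2 h2] with y hy
  obtain ⟨k, hk⟩ := exists_nat_gt (dist y x)
  exact hy k (by rw [mem_ball]; linarith)

/-- Hedberg's inequality. -/
lemma rieszPotential_le_hedberg {a p : ℝ} (ha : 0 < a) (hp : 1 < p)
    (hap : a * p < Module.finrank ℝ E) :
    ∃ A : ℝ≥0∞, A ≠ ⊤ ∧ ∀ f : E → ℝ≥0∞, Measurable f → ∫⁻ y, f y ^ p ∂μ ≠ ⊤ →
      ∫⁻ y, f y ^ p ∂μ ≠ 0 → ∀ x : E,
      rieszPotential μ (Module.finrank ℝ E - a) f x ≤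
        A * (dyadicMaximal μ f x ^ (1 - a * p / Module.finrank ℝ E) *
          (∫⁻ y, f y ^ p ∂μ) ^ (a / Module.finrank ℝ E)) := by
  obtain ⟨A, hA, h⟩ := rieszPotential_le_add μ ha hp hap
  set d := Module.finrank ℝ E with hd
  have hp0 : 0 < p := by linarith
  have hd0 : (0 : ℝ) < d := lt_of_lt_of_le (by positivity) hap.le
  refine ⟨A * 2, by finiteness, fun f hf hNt hN0 x => ?_⟩
  set M := dyadicMaximal μ f x with hM
  set N := ∫⁻ y, f y ^ p ∂μ with hN
  have he : 0 < 1 - a * p / d := by rw [sub_pos, div_lt_one hd0]; exact hap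
  have hNpow : N ^ (a / d) ≠ 0 := by
    simp [ENNReal.rpow_eq_zero_iff, hN0, hNt]
  by_cases hM0 : M = 0
  · exfalso
    have h0 := (lintegral_eq_zero_iff hf).1 (ae_eq_zero_of_dyadicMaximal_eq_zero μ hf hM0)
    apply hN0
    rw [hN, lintegral_eq_zero_iff (by fun_prop)]
    filter_upwards [h0] with y hy
    simp [hy, hp0]
  by_cases hMt : M = ⊤
  -- An infinite maximal function makes the right side `⊤` unless the constant is 0, since `0 * ⊤ =
  -- 0`.
  · rcases eq_or_ne A 0 with hA0 | hA0
    · have := h f hf x 1 one_pos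
      simpa [hA0] using this
    rw [hMt, ENNReal.top_rpow_of_pos he, ENNReal.top_mul hNpow, ENNReal.mul_top (by positivity)]
    exact le_top
  lift M to ℝ≥0 using hMt with M' hM'
  lift N to ℝ≥0 using hNt with N' hN'
  have hM0' : 0 < (M' : ℝ) := by
    simpa [pos_iff_ne_zero] using hM0
  have hN0' : 0 < (N' : ℝ) := by
    simpa [pos_iff_ne_zero] using hN0
  -- This is the radius at which the near and far terms `M R^a` and `N^(1/p) R^(-(d/p-a))` coincide.
  have hR : 0 < ((N' : ℝ) ^ (1 / p) / M') ^ (p / d) := by positivity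
  refine (h f hf x _ hR).trans (le_of_eq ?_)
  rw [← hM, ← hN, mul_assoc]
  congr 1
  have hRe : ∀ c : ℝ, (((N' : ℝ) ^ (1 / p) / M') ^ (p / d)) ^ c =
      (N' : ℝ) ^ (c / d) * (M' : ℝ) ^ (-(c * p / d)) := by
    intro c
    have i1 : 1 / p * (p / d * c) = c / d := by field_simp
    have i2 : p / d * c = c * p / d := by ring
    rw [← Real.rpow_mul (by positivity), Real.div_rpow (by positivity) hM0'.le,
      ← Real.rpow_mul hN0'.le, i1, i2, Real.rpow_neg hM0'.le, div_eq_mul_inv]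
  have e1 : (M' : ℝ) * (((N' : ℝ) ^ (1 / p) / M') ^ (p / d)) ^ a =
      (N' : ℝ) ^ (a / d) * (M' : ℝ) ^ (1 - a * p / d) := by
    rw [hRe, mul_left_comm]
    congr 1
    conv_lhs => rw [← Real.rpow_one (M' : ℝ), ← Real.rpow_mul hM0'.le, one_mul]
    rw [← Real.rpow_add hM0']
    congr 1
  have e2 : (N' : ℝ) ^ (1 / p) * (((N' : ℝ) ^ (1 / p) / M') ^ (p / d)) ^ (-(d / p - a)) =
      (N' : ℝ) ^ (a / d) * (M' : ℝ) ^ (1 - a * p / d) := by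
    rw [hRe, ← mul_assoc, ← Real.rpow_add hN0']
    congr 2
    · field_simp; ring
    · field_simp
  have c1 : (M' : ℝ≥0∞) = ENNReal.ofReal M' := (ENNReal.ofReal_coe_nnreal).symm
  have c2 : (N' : ℝ≥0∞) = ENNReal.ofReal N' := (ENNReal.ofReal_coe_nnreal).symm
  rw [c1, c2, ENNReal.ofReal_rpow_of_pos hN0', ENNReal.ofReal_rpow_of_pos hN0',
    ENNReal.ofReal_rpow_of_pos hM0', ← ENNReal.ofReal_mul (by positivity),
    ← ENNReal.ofReal_mul (by positivity), ← ENNReal.ofReal_mul (by positivity), e1, e2, two_mul,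
    mul_comm]

/-- The Hardy-Littlewood-Sobolev inequality. -/
theorem lintegral_rieszPotential_rpow_le {a p : ℝ} (ha : 0 < a) (hp : 1 < p)
    (hap : a * p < Module.finrank ℝ E) :
    ∃ C : ℝ≥0∞, C ≠ ⊤ ∧ ∀ f : E → ℝ≥0∞, Measurable f →
      (∫⁻ x, rieszPotential μ (Module.finrank ℝ E - a) f x ^
          (Module.finrank ℝ E * p / (Module.finrank ℝ E - a * p)) ∂μ) ^
          (1 / (Module.finrank ℝ E * p / (Module.finrank ℝ E - a * p)) : ℝ) ≤
        C * (∫⁻ x, f x ^ p ∂μ) ^ (1 / p) := by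
  obtain ⟨A, hA, h⟩ := rieszPotential_le_hedberg μ ha hp hap
  obtain ⟨B, hB, hmax⟩ := lintegral_dyadicMaximal_rpow_le μ hp
  set d := Module.finrank ℝ E with hd
  have hp0 : 0 < p := by linarith
  have hd0 : (0 : ℝ) < d := lt_of_lt_of_le (by positivity) hap.le
  have hdp : 0 < d - a * p := by linarith
  set q : ℝ := d * p / (d - a * p) with hq
  have hq0 : 0 < q := by positivity
  -- The exponent `q` is the one for which the `q`-th power of Hedberg's bound contains the maximal
  -- function to the power `p`.
  have hqe : (1 - a * p / d) * q = p := by rw [hq]; field_simp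
  have hqe2 : (a / d * q + 1) * (1 / q) = 1 / p := by rw [hq]; field_simp; ring
  -- Adding 1 keeps the constant nonzero, so that the right side is `⊤` when the norm of `f` is
  -- infinite.
  refine ⟨A * B ^ (1 / q) + 1, ENNReal.add_ne_top.2 ⟨ENNReal.mul_ne_top hA
    (ENNReal.rpow_ne_top_of_nonneg (by positivity) hB), ENNReal.one_ne_top⟩, fun f hf => ?_⟩
  by_cases hN0 : ∫⁻ y, f y ^ p ∂μ = 0
  · have h0 : ∀ᵐ y ∂μ, f y = 0 := by
      have := (lintegral_eq_zero_iff (by fun_prop)).1 hN0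
      filter_upwards [this] with y hy
      exact (ENNReal.rpow_eq_zero_iff_of_pos hp0).1 hy
    have h1 : ∀ x, rieszPotential μ (d - a) f x = 0 := fun x => by
      rw [rieszPotential, lintegral_eq_zero_iff (by fun_prop)]
      filter_upwards [h0] with y hy
      simp [hy]
    simp [h1, hq0]
  by_cases hNt : ∫⁻ y, f y ^ p ∂μ = ⊤
  · rw [hNt, ENNReal.top_rpow_of_pos (by positivity), ENNReal.mul_top (by simp)]
    exact le_top
  set N := ∫⁻ y, f y ^ p ∂μ with hN
  calc (∫⁻ x, rieszPotential μ (d - a) f x ^ q ∂μ) ^ (1 / q)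
      ≤ (∫⁻ x, A ^ q * N ^ (a / d * q) * dyadicMaximal μ f x ^ p ∂μ) ^ (1 / q) := by
        refine ENNReal.rpow_le_rpow (lintegral_mono fun x => ?_) (by positivity)
        refine (ENNReal.rpow_le_rpow (h f hf hNt hN0 x) hq0.le).trans (le_of_eq ?_)
        rw [ENNReal.mul_rpow_of_nonneg _ _ hq0.le, ENNReal.mul_rpow_of_nonneg _ _ hq0.le,
          ← ENNReal.rpow_mul, hqe, ← ENNReal.rpow_mul]
        ring
    _ = (A ^ q * N ^ (a / d * q) * ∫⁻ x, dyadicMaximal μ f x ^ p ∂μ) ^ (1 / q) := by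
        rw [lintegral_const_mul _ ((measurable_dyadicMaximal μ hf).pow_const p)]
    _ ≤ (A ^ q * N ^ (a / d * q) * (B * N)) ^ (1 / q) := by
        gcongr
        exact hmax f hf
    _ = (A ^ q * B * N ^ (a / d * q + 1)) ^ (1 / q) := by
        rw [ENNReal.rpow_add_of_nonneg _ _ (by positivity) zero_le_one, ENNReal.rpow_one]
        ring_nf
    _ = A * B ^ (1 / q) * N ^ (1 / p) := by
        rw [ENNReal.mul_rpow_of_nonneg _ _ (by positivity),
          ENNReal.mul_rpow_of_nonneg _ _ (by positivity), ← ENNReal.rpow_mul, ← ENNReal.rpow_mul,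
          hqe2, mul_one_div_cancel hq0.ne', ENNReal.rpow_one]
    _ ≤ _ := by
        gcongr
        exact le_self_add

/-! ### Riesz potentials on the unit ball: the endpoint cases -/

lemma exists_lintegral_ball_norm_rpow_le {b : ℝ} (hb : b < Module.finrank ℝ E) :
    ∃ C : ℝ≥0∞, C ≠ ⊤ ∧ ∀ x ∈ ball (0 : E) 1,
      ∫⁻ y in ball (0 : E) 1, ENNReal.ofReal (‖x - y‖ ^ (-b)) ∂μ ≤ C := by
  -- Differences of points of the unit ball lie in the ball of radius 2, so this integral dominates
  -- uniformly in `x`.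
  refine ⟨∫⁻ z in ball (0 : E) 2, ENNReal.ofReal (‖z‖ ^ (-b)) ∂μ, ?_, fun x hx => ?_⟩
  · have hI : IntegrableOn (fun z : E => ‖z‖ ^ (-b)) (ball 0 2) μ := by
      rw [integrableOn_fun_norm_addHaar μ (f := fun t => t ^ (-b))]
      have h1 : IntegrableOn (fun t : ℝ => t ^ ((Module.finrank ℝ E : ℝ) - 1 - b)) (Ioo 0 2) :=
        (intervalIntegral.integrableOn_Ioo_rpow_iff two_pos).2 (by linarith)
      refine h1.congr_fun (fun t ht => ?_) measurableSet_Ioo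
      have hd : 1 ≤ Module.finrank ℝ E := Module.finrank_pos
      dsimp only
      rw [smul_eq_mul, ← Real.rpow_natCast, ← Real.rpow_add ht.1, Nat.cast_sub hd, Nat.cast_one,
        sub_eq_add_neg _ b]
    exact hI.lintegral_lt_top.ne
  · rw [← lintegral_indicator measurableSet_ball, ← lintegral_indicator measurableSet_ball,
      ← lintegral_sub_left_eq_self
        ((ball (0 : E) 2).indicator fun z => ENNReal.ofReal (‖z‖ ^ (-b))) x]
    refine lintegral_mono fun y => ?_
    by_cases hy : y ∈ ball (0 : E) 1
    · have h2 : x - y ∈ ball (0 : E) 2 := by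
        rw [mem_ball_zero_iff] at *
        linarith [norm_sub_le x y]
      rw [indicator_of_mem hy, indicator_of_mem h2]
    · rw [indicator_of_notMem hy]
      exact zero_le

/-- With `k` the kernel and `N = ∫ f`, Hölder with `f = f^(1/q) f^(1/q')` gives `(∫ f k)^q ≤ N^(q-1)
∫ f k^q`. Tonelli then integrates `k^q` in `x` first, with a bound independent of `y` because `b q <
d`. -/
lemma lintegral_rieszPotential_ball_rpow_le {b q : ℝ} (hq : 1 ≤ q)
    (hbq : b * q < Module.finrank ℝ E) :
    ∃ C : ℝ≥0∞, C ≠ ⊤ ∧ ∀ f : E → ℝ≥0∞, Measurable f →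
      (∫⁻ x in ball (0 : E) 1, rieszPotential (μ.restrict (ball 0 1)) b f x ^ q ∂μ) ^ (1 / q) ≤
        C * ∫⁻ x in ball (0 : E) 1, f x ∂μ := by
  obtain ⟨C, hC, h⟩ := exists_lintegral_ball_norm_rpow_le μ hbq
  have hq0 : 0 < q := by linarith
  refine ⟨C ^ (1 / q), ENNReal.rpow_ne_top_of_nonneg (by positivity) hC, fun f hf => ?_⟩
  set ν := μ.restrict (ball (0 : E) 1)
  set N := ∫⁻ x, f x ∂ν
  have hpt : ∀ x, rieszPotential ν b f x ^ q ≤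
      N ^ (q - 1) * ∫⁻ y, f y * ENNReal.ofReal (‖x - y‖ ^ (-(b * q))) ∂ν := by
    intro x
    have hk : ∀ y, ENNReal.ofReal (‖x - y‖ ^ (-b)) ^ q = ENNReal.ofReal (‖x - y‖ ^ (-(b * q))) := by
      intro y
      rw [ENNReal.ofReal_rpow_of_nonneg (by positivity) hq0.le, ← Real.rpow_mul (norm_nonneg _),
        neg_mul]
    rcases hq.eq_or_lt with rfl | hq1
    · simp [rieszPotential]
    have hpq : q.HolderConjugate q.conjExponent := Real.HolderConjugate.conjExponent hq1
    have hone : 1 / q + 1 / q.conjExponent = 1 := by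
      simpa only [one_div] using hpq.inv_add_inv_eq_one
    have hp0 : 0 < 1 / q.conjExponent := by
      have := hpq.symm.pos
      positivity
    have hsplit : rieszPotential ν b f x = ∫⁻ y, ((fun y => f y ^ (1 / q) *
        ENNReal.ofReal (‖x - y‖ ^ (-b))) * fun y => f y ^ (1 / q.conjExponent)) y ∂ν := by
      refine lintegral_congr fun y => ?_
      simp only [Pi.mul_apply]
      rw [mul_right_comm, ← ENNReal.rpow_add_of_nonneg _ _ (by positivity) hp0.le, hone,
        ENNReal.rpow_one]
    have hH := ENNReal.lintegral_mul_le_Lp_mul_Lq ν hpq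
      (f := fun y => f y ^ (1 / q) * ENNReal.ofReal (‖x - y‖ ^ (-b)))
      (g := fun y => f y ^ (1 / q.conjExponent)) (by fun_prop) (by fun_prop)
    rw [← hsplit] at hH
    refine (ENNReal.rpow_le_rpow hH hq0.le).trans (le_of_eq ?_)
    have e1 : ∀ y, (f y ^ (1 / q.conjExponent)) ^ q.conjExponent = f y := fun y => by
      rw [← ENNReal.rpow_mul, one_div_mul_cancel hpq.symm.pos.ne', ENNReal.rpow_one]
    have e2 : ∀ y, (f y ^ (1 / q) * ENNReal.ofReal (‖x - y‖ ^ (-b))) ^ q =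
        f y * ENNReal.ofReal (‖x - y‖ ^ (-(b * q))) := fun y => by
      rw [ENNReal.mul_rpow_of_nonneg _ _ hq0.le, ← ENNReal.rpow_mul,
        one_div_mul_cancel hq0.ne', ENNReal.rpow_one, hk]
    simp_rw [e1, e2]
    rw [ENNReal.mul_rpow_of_nonneg _ _ hq0.le, ← ENNReal.rpow_mul, one_div_mul_cancel hq0.ne',
      ENNReal.rpow_one, ← ENNReal.rpow_mul, mul_comm]
    congr 2
    have : 1 / q.conjExponent = 1 - 1 / q := by linarith
    rw [this]
    field_simp
  have hm : Measurable (fun z : E × E => f z.2 * ENNReal.ofReal (‖z.1 - z.2‖ ^ (-(b * q)))) := by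
    fun_prop
  have hint : ∫⁻ x, rieszPotential ν b f x ^ q ∂ν ≤ C * N ^ q := by
    calc _ ≤ ∫⁻ x, N ^ (q - 1) * ∫⁻ y, f y * ENNReal.ofReal (‖x - y‖ ^ (-(b * q))) ∂ν ∂ν :=
          lintegral_mono hpt
      _ = N ^ (q - 1) * ∫⁻ y, ∫⁻ x, f y * ENNReal.ofReal (‖x - y‖ ^ (-(b * q))) ∂ν ∂ν := by
          rw [lintegral_const_mul _ (Measurable.lintegral_prod_right' hm),
            lintegral_lintegral_swap hm.aemeasurable]
      _ ≤ N ^ (q - 1) * ∫⁻ y, f y * C ∂ν := by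
          gcongr 1
          refine setLIntegral_mono' measurableSet_ball fun y hy => ?_
          rw [lintegral_const_mul _ (by fun_prop)]
          gcongr
          simp_rw [norm_sub_rev _ y]
          exact h y hy
      _ = C * (N ^ (q - 1) * N) := by
          rw [lintegral_mul_const _ hf]
          ring
      _ = C * N ^ q := by
          congr 1
          conv_lhs => rw [← ENNReal.rpow_one N, ← ENNReal.rpow_mul, one_mul]
          rw [← ENNReal.rpow_add_of_nonneg _ _ (by linarith) zero_le_one, sub_add_cancel]
  calc _ ≤ (C * N ^ q) ^ (1 / q) := ENNReal.rpow_le_rpow hint (by positivity)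
    _ = _ := by
      rw [ENNReal.mul_rpow_of_nonneg _ _ (by positivity), ← ENNReal.rpow_mul,
        mul_one_div_cancel hq0.ne', ENNReal.rpow_one]

/-- Hölder: the kernel lies in `L^p'` of the ball when `(d - a) p' < d`, which is `d < a p`. -/
lemma rieszPotential_ball_le_rpow {a p : ℝ} (hp : 1 < p) (hap : Module.finrank ℝ E < a * p) :
    ∃ C : ℝ≥0∞, C ≠ ⊤ ∧ ∀ f : E → ℝ≥0∞, Measurable f → ∀ x ∈ ball (0 : E) 1,
      rieszPotential (μ.restrict (ball 0 1)) (Module.finrank ℝ E - a) f x ≤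
        C * (∫⁻ x in ball (0 : E) 1, f x ^ p ∂μ) ^ (1 / p) := by
  have hpq : p.HolderConjugate p.conjExponent := Real.HolderConjugate.conjExponent hp
  have hq0 : 0 < p.conjExponent := hpq.symm.pos
  have hb : (Module.finrank ℝ E - a) * p.conjExponent < Module.finrank ℝ E := by
    rw [Real.conjExponent, ← mul_div_assoc, div_lt_iff₀ (by linarith)]
    nlinarith
  obtain ⟨C, hC, h⟩ := exists_lintegral_ball_norm_rpow_le μ hb
  refine ⟨C ^ (1 / p.conjExponent), ENNReal.rpow_ne_top_of_nonneg (by positivity) hC,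
    fun f hf x hx => ?_⟩
  have hH := ENNReal.lintegral_mul_le_Lp_mul_Lq (μ.restrict (ball (0 : E) 1)) hpq
      (f := f) (g := fun y => ENNReal.ofReal (‖x - y‖ ^ (-(Module.finrank ℝ E - a))))
      (by fun_prop) (by fun_prop)
  refine hH.trans ?_
  rw [mul_comm]
  gcongr
  refine le_trans (le_of_eq (lintegral_congr fun y => ?_)) (h x hx)
  rw [ENNReal.ofReal_rpow_of_nonneg (by positivity) hq0.le, ← Real.rpow_mul (norm_nonneg _),
    neg_mul]

lemma rieszPotential_ball_le_essSup {b : ℝ} (hb : b < Module.finrank ℝ E) :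
    ∃ C : ℝ≥0∞, C ≠ ⊤ ∧ ∀ f : E → ℝ≥0∞, Measurable f → ∀ x ∈ ball (0 : E) 1,
      rieszPotential (μ.restrict (ball 0 1)) b f x ≤ C * essSup f (μ.restrict (ball 0 1)) := by
  obtain ⟨C, hC, h⟩ := exists_lintegral_ball_norm_rpow_le μ hb
  refine ⟨C, hC, fun f hf x hx => ?_⟩
  calc rieszPotential (μ.restrict (ball 0 1)) b f x
      ≤ ∫⁻ y in ball (0 : E) 1, essSup f (μ.restrict (ball 0 1)) *
          ENNReal.ofReal (‖x - y‖ ^ (-b)) ∂μ := by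
        refine lintegral_mono_ae ?_
        filter_upwards [ENNReal.ae_le_essSup f] with y hy
        gcongr
    _ = (∫⁻ y in ball (0 : E) 1, ENNReal.ofReal (‖x - y‖ ^ (-b)) ∂μ) *
          essSup f (μ.restrict (ball 0 1)) := by
        rw [lintegral_const_mul _ (by fun_prop), mul_comm]
    _ ≤ _ := by
        gcongr
        exact h x hx

end Riesz

/-! ### The radial profile of Green's function -/

/-- The incomplete beta integral `∫₀ᶻ t^(s-1) / (1+t)^k dt`. -/
noncomputable def greenProfile (s k z : ℝ) : ℝ := ∫ t in (0 : ℝ)..z, t ^ (s - 1) / (1 + t) ^ k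

section Profile

variable {s k z : ℝ}

lemma intervalIntegrable_greenProfile (hs : 0 < s) (hz : 0 ≤ z) :
    IntervalIntegrable (fun t : ℝ => t ^ (s - 1) / (1 + t) ^ k) volume 0 z := by
  simp_rw [div_eq_mul_inv]
  refine (intervalIntegral.intervalIntegrable_rpow' (by linarith)).mul_continuousOn ?_
  rw [uIcc_of_le hz]
  refine ContinuousOn.inv₀ (ContinuousOn.rpow_const (by fun_prop) ?_) ?_
  · exact fun t ht => Or.inl (by linarith [ht.1])
  · exact fun t ht => (Real.rpow_pos_of_pos (by linarith [ht.1]) _).ne'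

lemma hasDerivAt_greenProfile (hs : 0 < s) (hz : 0 < z) :
    HasDerivAt (greenProfile s k) (z ^ (s - 1) / (1 + z) ^ k) z := by
  refine intervalIntegral.integral_hasDerivAt_right (intervalIntegrable_greenProfile hs hz.le) ?_ ?_
  · exact (by fun_prop : Measurable fun t : ℝ =>
      t ^ (s - 1) / (1 + t) ^ k).stronglyMeasurable.stronglyMeasurableAtFilter
  · refine ContinuousAt.div (Real.continuousAt_rpow_const _ _ (Or.inl hz.ne'))
      (ContinuousAt.rpow_const (by fun_prop) (Or.inl (by linarith)))
      (Real.rpow_pos_of_pos (by linarith) _).ne'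

lemma continuousWithinAt_greenProfile_zero (hs : 0 < s) :
    ContinuousWithinAt (greenProfile s k) (Ici 0) 0 := by
  have h := intervalIntegral.continuousWithinAt_primitive (f := fun t : ℝ => t ^ (s - 1) / (1 + t) ^ k)
    (μ := volume) (a := 0) (b₀ := 0) (b₁ := 0) (b₂ := 1) (by simp)
    (by simpa using intervalIntegrable_greenProfile hs zero_le_one)
  exact h.mono_of_mem_nhdsWithin (Icc_mem_nhdsGE one_pos)

lemma greenProfile_zero : greenProfile s k 0 = 0 := by simp [greenProfile]

lemma greenProfile_nonneg (hz : 0 ≤ z) : 0 ≤ greenProfile s k z :=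
  intervalIntegral.integral_nonneg hz fun t ht =>
    div_nonneg (Real.rpow_nonneg ht.1 _) (Real.rpow_nonneg (by linarith [ht.1]) _)

lemma measurable_indicator_greenProfile (hs : 0 < s) :
    Measurable ((Ioi (0 : ℝ)).indicator (greenProfile s k)) := by
  have h : ContinuousOn (greenProfile s k) (Ioi 0) := fun z hz =>
    (hasDerivAt_greenProfile hs hz).continuousAt.continuousWithinAt
  rw [← piecewise_eq_indicator]
  exact h.measurable_piecewise continuousOn_const measurableSet_Ioi

/-- The reason is `t^e ≤ (1+t)^k`. The choice `e = 0` gives the behaviour `z^s` near 0; `e = 1/2`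
controls the growth for every `k ≥ 1/2`, so dimension 1, where the profile is unbounded, needs no
separate argument. -/
lemma greenProfile_le_rpow_div {e : ℝ} (hs : 0 < s) (hk : e ≤ k) (he : 0 ≤ e) (hse : e < s)
    (hz : 0 ≤ z) : greenProfile s k z ≤ z ^ (s - e) / (s - e) := by
  have h1 : ∫ t in (0 : ℝ)..z, t ^ (s - e - 1) = z ^ (s - e) / (s - e) := by
    rw [integral_rpow (Or.inl (by linarith)), sub_add_cancel, Real.zero_rpow (by linarith), sub_zero]
  rw [← h1]
  refine intervalIntegral.integral_mono_on_of_le_Ioo hz (intervalIntegrable_greenProfile hs hz)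
    (intervalIntegral.intervalIntegrable_rpow' (by linarith)) fun t ht => ?_
  have ht0 : 0 < t := ht.1
  rw [sub_right_comm, Real.rpow_sub ht0 (s - 1) e]
  have : t ^ e ≤ (1 + t) ^ k :=
    (Real.rpow_le_rpow ht0.le (by linarith) he).trans
      (Real.rpow_le_rpow_of_exponent_le (by linarith) hk)
  gcongr

/-- Beyond `t = 1` the integrand is at most `t^(s-2)`, integrable at infinity because `s < 1`. -/
lemma greenProfile_le_const (hs : 0 < s) (hs1 : s < 1) (hk : 1 ≤ k) (hz : 0 ≤ z) :
    greenProfile s k z ≤ 1 / s + 1 / (1 - s) := by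
  have h0 : 0 < 1 / (1 - s) := by
    have : 0 < 1 - s := by linarith
    positivity
  rcases le_total z 1 with h | h
  · have h1 := greenProfile_le_rpow_div (k := k) (e := 0) hs (by linarith) le_rfl hs hz
    rw [sub_zero] at h1
    have h2 : z ^ s / s ≤ 1 / s := by
      gcongr
      exact Real.rpow_le_one hz h hs.le
    linarith
  · have h1 := greenProfile_le_rpow_div (k := k) (e := 0) hs (by linarith) le_rfl hs zero_le_one
    rw [sub_zero, Real.one_rpow] at h1
    have hI := intervalIntegrable_greenProfile (k := k) hs hz
    have hI1 := intervalIntegrable_greenProfile (k := k) hs zero_le_one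
    have hIz : IntervalIntegrable (fun t : ℝ => t ^ (s - 1) / (1 + t) ^ k) volume 1 z :=
      hI1.symm.trans hI
    have h2 : ∫ t in (1 : ℝ)..z, t ^ (s - 1) / (1 + t) ^ k ≤ 1 / (1 - s) := by
      have h0z : (0 : ℝ) ∉ uIcc 1 z := by
        rw [uIcc_of_le h]; exact fun h => by linarith [h.1]
      have h3 : ∫ t in (1 : ℝ)..z, t ^ (s - 2) = (z ^ (s - 1) - 1) / (s - 1) := by
        rw [integral_rpow (Or.inr ⟨by linarith, h0z⟩), Real.one_rpow,
          show s - 2 + 1 = s - 1 by ring]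
      calc _ ≤ ∫ t in (1 : ℝ)..z, t ^ (s - 2) := by
            refine intervalIntegral.integral_mono_on h hIz
              (intervalIntegral.intervalIntegrable_rpow (Or.inr h0z)) fun t ht => ?_
            have ht0 : 0 < t := by linarith [ht.1]
            have e1 : s - 2 = s - 1 - 1 := by ring
            rw [e1, Real.rpow_sub ht0 (s - 1) 1]
            have : t ^ (1 : ℝ) ≤ (1 + t) ^ k :=
              (Real.rpow_le_rpow ht0.le (by linarith) zero_le_one).trans
                (Real.rpow_le_rpow_of_exponent_le (by linarith) hk)
            gcongr
        _ = (1 - z ^ (s - 1)) / (1 - s) := by rw [h3, ← neg_div_neg_eq]; congr 1 <;> ring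
        _ ≤ _ := by
            have : 0 ≤ z ^ (s - 1) := Real.rpow_nonneg hz _
            have : 0 < 1 - s := by linarith
            gcongr
            linarith
    have h4 : greenProfile s k z = greenProfile s k 1 + ∫ t in (1 : ℝ)..z, t ^ (s - 1) / (1 + t) ^ k :=
      (intervalIntegral.integral_add_adjacent_intervals hI1 hIz).symm
    linarith

/-- Both sides vanish at 0 and have the same derivative. Up to a power of `d`, the left side is the
derivative of `d^(s-k) Φ(a/d)` in `d`; the right side expresses it by the profile of index `k+1`,
which is bounded for `k = n/2` in every dimension. -/
lemma greenProfile_recurrence (hs : 0 < s) (hz : 0 < z) :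
    (s - k) * greenProfile s k z - z * (z ^ (s - 1) / (1 + z) ^ k) =
      -k * greenProfile s (k + 1) z := by
  set F : ℝ → ℝ := fun z => (s - k) * greenProfile s k z - z ^ s / (1 + z) ^ k
    + k * greenProfile s (k + 1) z with hF
  have hder : ∀ t : ℝ, 0 < t → HasDerivAt F 0 t := by
    intro t ht
    have h1 := (hasDerivAt_greenProfile (k := k) hs ht).const_mul (s - k)
    have h2 := (hasDerivAt_greenProfile (k := k + 1) hs ht).const_mul k
    have h3 : HasDerivAt (fun t : ℝ => t ^ s) (s * t ^ (s - 1)) t :=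
      Real.hasDerivAt_rpow_const (Or.inl ht.ne')
    have h1t : 0 < 1 + t := by linarith
    have h4 : HasDerivAt (fun t : ℝ => (1 + t) ^ k) (k * (1 + t) ^ (k - 1)) t := by
      have := ((hasDerivAt_id t).const_add 1).rpow_const (p := k) (Or.inl h1t.ne')
      simpa using this
    have hne : (1 + t) ^ k ≠ 0 := (Real.rpow_pos_of_pos h1t _).ne'
    have := (h1.sub (h3.div h4 hne)).add h2
    refine this.congr_deriv ?_
    rw [Real.rpow_add_one h1t.ne', Real.rpow_sub_one h1t.ne', Real.rpow_sub_one ht.ne']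
    field_simp
    ring
  have hcont : ContinuousOn F (Icc 0 z) := by
    intro t ht
    rcases ht.1.eq_or_lt with rfl | ht0
    · have c1 := (continuousWithinAt_greenProfile_zero (k := k) hs).mono
        (Icc_subset_Ici_self : Icc 0 z ⊆ Ici 0)
      have c2 := (continuousWithinAt_greenProfile_zero (k := k + 1) hs).mono
        (Icc_subset_Ici_self : Icc 0 z ⊆ Ici 0)
      refine ((c1.const_mul _).sub (ContinuousAt.continuousWithinAt ?_)).add (c2.const_mul _)
      refine ContinuousAt.div (Real.continuousAt_rpow_const _ _ (Or.inr hs.le))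
        (ContinuousAt.rpow_const (by fun_prop) (Or.inl (by norm_num))) (by simp)
    · exact (hder t ht0).continuousAt.continuousWithinAt
  obtain ⟨c, -, hc⟩ := exists_hasDerivAt_eq_slope F (fun _ => 0) hz hcont fun t ht => hder t ht.1
  have hF0 : F 0 = 0 := by simp [hF, greenProfile_zero, Real.zero_rpow hs.ne']
  rw [hF0, sub_zero, sub_zero, eq_comm, div_eq_zero_iff, or_iff_left hz.ne'] at hc
  have hz1 : z * (z ^ (s - 1) / (1 + z) ^ k) = z ^ s / (1 + z) ^ k := by
    rw [Real.rpow_sub_one hz.ne']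
    field_simp
  rw [hz1]
  simp only [hF] at hc
  linarith

end Profile

/-! ### Pointwise estimates in terms of boundary distances -/

section Estimates

variable {X Y D d a s m r : ℝ}

/-- In this section `X = 1-|x|`, `Y = 1-|y|`, `D = |x-y|`, `d = D² + ε` and `a = (1-|x|²)(1-|y|²)`;
assuming only `D² ≤ d` makes the estimates uniform in `ε ≥ 0`. Here either `D ≥ X/2`, so `d ≥ X²/4`,
or `Y ≥ X/2`, so `a ≥ X²/2`. -/
lemma sq_le_four_mul_add (hX : 0 < X) (hXY : X - Y ≤ D) (hd : D ^ 2 ≤ d)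
    (ha : X * Y ≤ a) (ha0 : 0 ≤ a) : X ^ 2 ≤ 4 * (d + a) := by
  rcases le_total (X / 2) D with h | h
  · nlinarith
  · nlinarith

/-- From `X² ≤ 8 max(d, a)`: if `a` is the larger, `X² ≤ 8a ≤ 32 X Y`; if `d` is, `a X ≤ 4 X² Y ≤ 32
d Y`. This converts smallness of `a/d` into powers of `Y/X`. -/
lemma min_one_div_le (hX : 0 < X) (hXY : X - Y ≤ D) (hd0 : 0 < d) (hd : D ^ 2 ≤ d)
    (ha : X * Y ≤ a) (ha0 : 0 ≤ a) (ha' : a ≤ 4 * (X * Y)) : min 1 (a / d) ≤ 32 * (Y / X) := by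
  have key := sq_le_four_mul_add hX hXY hd ha ha0
  rw [← mul_div_assoc, le_div_iff₀ hX]
  rcases le_total d a with h | h
  · have h1 : min 1 (a / d) ≤ 1 := min_le_left _ _
    nlinarith
  · have h1 : min 1 (a / d) ≤ a / d := min_le_right _ _
    refine (mul_le_mul_of_nonneg_right h1 hX.le).trans ?_
    rw [div_mul_eq_mul_div, div_le_iff₀ hd0]
    have h2 : X ^ 2 ≤ 8 * d := by linarith
    have hY : 0 ≤ Y := by
      by_contra hY
      nlinarith [mul_pos hX (neg_pos.2 (not_le.1 hY))]
    nlinarith [mul_le_mul_of_nonneg_right ha' hX.le, mul_le_mul_of_nonneg_right h2 hY]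

/-- The profile is at most a multiple of `z^(s-1/2) min(1,z)^(1/2)`; the second factor is traded for
`(Y/X)^(1/2)`. The resulting `D^(1-2m)`, with `2m = n`, is not the sharp singularity, but it is
locally integrable and that is all Fubini and dominated convergence require. -/
lemma greenProfile_term_le (hs : 1 / 2 < s) (hm : 1 / 2 ≤ m) (hX : 0 < X) (hY : 0 < Y)
    (hD : 0 < D) (hXY : X - Y ≤ D) (hd : D ^ 2 ≤ d) (ha : X * Y ≤ a) (ha' : a ≤ 4 * (X * Y)) :
    d ^ (s - m) * greenProfile s m (a / d) ≤
      (1 / (s - 1 / 2) * 4 ^ (s - 1 / 2) * 32 ^ (1 / 2 : ℝ)) *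
        (X ^ (s - 1) * Y ^ s * D ^ (1 - 2 * m)) := by
  have hd0 : 0 < d := lt_of_lt_of_le (by positivity) hd
  have ha0 : 0 < a := lt_of_lt_of_le (by positivity) ha
  have hz : 0 < a / d := by positivity
  have hs2 : 0 < s - 1 / 2 := by linarith
  have hmin := min_one_div_le hX hXY hd0 hd ha ha0.le ha'
  have hmin0 : 0 < min 1 (a / d) := lt_min one_pos hz
  have h1 : greenProfile s m (a / d) ≤
      1 / (s - 1 / 2) * ((a / d) ^ (s - 1 / 2) * min 1 (a / d) ^ (1 / 2 : ℝ)) := by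
    rcases le_total 1 (a / d) with h | h
    · rw [min_eq_left h, Real.one_rpow, mul_one, one_div_mul_eq_div]
      exact greenProfile_le_rpow_div (by linarith) hm (by norm_num) hs hz.le
    · rw [min_eq_right h, ← Real.rpow_add hz, sub_add_cancel, one_div_mul_eq_div]
      refine (greenProfile_le_rpow_div (e := 0) (by linarith) (by linarith) le_rfl (by linarith)
        hz.le).trans ?_
      rw [sub_zero]
      gcongr
      linarith
  have h2 : min 1 (a / d) ^ (1 / 2 : ℝ) ≤ 32 ^ (1 / 2 : ℝ) * (Y / X) ^ (1 / 2 : ℝ) := by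
    rw [← Real.mul_rpow (by norm_num) (by positivity)]
    exact Real.rpow_le_rpow hmin0.le hmin (by norm_num)
  have h3 : d ^ (s - m) * (a / d) ^ (s - 1 / 2) = d ^ (1 / 2 - m) * a ^ (s - 1 / 2) := by
    rw [Real.div_rpow ha0.le hd0.le, mul_div_assoc', mul_div_right_comm, ← Real.rpow_sub hd0]
    congr 2
    ring
  have h4 : d ^ (1 / 2 - m) ≤ D ^ (1 - 2 * m) := by
    have : D ^ (1 - 2 * m) = (D ^ 2) ^ (1 / 2 - m) := by
      rw [← Real.rpow_natCast, ← Real.rpow_mul hD.le]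
      congr 1
      push_cast
      ring
    rw [this]
    exact Real.rpow_le_rpow_of_nonpos (by positivity) hd (by linarith)
  have h5 : a ^ (s - 1 / 2) ≤ 4 ^ (s - 1 / 2) * (X * Y) ^ (s - 1 / 2) := by
    rw [← Real.mul_rpow (by norm_num) (by positivity)]
    exact Real.rpow_le_rpow ha0.le ha' hs2.le
  have h6 : (X * Y) ^ (s - 1 / 2) * (Y / X) ^ (1 / 2 : ℝ) = X ^ (s - 1) * Y ^ s := by
    rw [Real.mul_rpow hX.le hY.le, Real.div_rpow hY.le hX.le, mul_div_assoc', mul_assoc,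
      ← Real.rpow_add hY, mul_div_right_comm, ← Real.rpow_sub hX]
    congr 2 <;> ring
  calc d ^ (s - m) * greenProfile s m (a / d)
      ≤ d ^ (s - m) * (1 / (s - 1 / 2) *
          ((a / d) ^ (s - 1 / 2) * (32 ^ (1 / 2 : ℝ) * (Y / X) ^ (1 / 2 : ℝ)))) := by
        gcongr
        refine h1.trans ?_
        gcongr
    _ = 1 / (s - 1 / 2) * 32 ^ (1 / 2 : ℝ) * (Y / X) ^ (1 / 2 : ℝ) *
          (d ^ (s - m) * (a / d) ^ (s - 1 / 2)) := by ring
    _ ≤ 1 / (s - 1 / 2) * 32 ^ (1 / 2 : ℝ) * (Y / X) ^ (1 / 2 : ℝ) *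
          (D ^ (1 - 2 * m) * (4 ^ (s - 1 / 2) * (X * Y) ^ (s - 1 / 2))) := by
        rw [h3]
        gcongr
    _ = (1 / (s - 1 / 2) * 4 ^ (s - 1 / 2) * 32 ^ (1 / 2 : ℝ)) *
          (((X * Y) ^ (s - 1 / 2) * (Y / X) ^ (1 / 2 : ℝ)) * D ^ (1 - 2 * m)) := by ring
    _ = _ := by rw [h6]

/-- The profile of index `m+1` is at most a multiple of `min(1,z)^s`, and `s` may be lowered to `r ≤
s` because the base is at most 1. -/
lemma greenProfile_gradient_radial_le (hs : 1 / 2 < s) (hs1 : s < 1) (hm : 1 / 2 ≤ m)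
    (hr : r ∈ Icc (1 - s) s) (hX : 0 < X) (hY : 0 < Y)
    (hD : 0 < D) (hXY : X - Y ≤ D) (hd : D ^ 2 ≤ d) (ha : X * Y ≤ a) (ha' : a ≤ 4 * (X * Y)) :
    D * (d ^ (s - m - 1) * greenProfile s (m + 1) (a / d)) ≤
      (1 / s + 1 / (1 - s)) * 32 * ((Y / X) ^ r * D ^ (2 * s - 2 * m - 1)) := by
  have hd0 : 0 < d := lt_of_lt_of_le (by positivity) hd
  have ha0 : 0 < a := lt_of_lt_of_le (by positivity) ha
  have hz : 0 < a / d := by positivity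
  have hs2 : 0 < 1 - s := by linarith
  have hs0 : 0 < s := by linarith
  have hr0 : 0 < r := by linarith [hr.1]
  have hmin := min_one_div_le hX hXY hd0 hd ha ha0.le ha'
  have hmin0 : 0 < min 1 (a / d) := lt_min one_pos hz
  have h1 : greenProfile s (m + 1) (a / d) ≤ (1 / s + 1 / (1 - s)) * min 1 (a / d) ^ s := by
    rcases le_total 1 (a / d) with h | h
    · rw [min_eq_left h, Real.one_rpow, mul_one]
      exact greenProfile_le_const (by linarith) hs1 (by linarith) hz.le
    · rw [min_eq_right h]
      refine (greenProfile_le_rpow_div (e := 0) (by linarith) (by linarith) le_rfl (by linarith)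
        hz.le).trans ?_
      rw [sub_zero, div_eq_inv_mul, ← one_div]
      gcongr
      have : 0 < 1 / (1 - s) := by positivity
      linarith
  have h2 : min 1 (a / d) ^ s ≤ 32 * (Y / X) ^ r := by
    calc min 1 (a / d) ^ s ≤ min 1 (a / d) ^ r :=
          Real.rpow_le_rpow_of_exponent_ge hmin0 (min_le_left _ _) hr.2
      _ ≤ (32 * (Y / X)) ^ r := Real.rpow_le_rpow hmin0.le hmin hr0.le
      _ = 32 ^ r * (Y / X) ^ r := Real.mul_rpow (by norm_num) (by positivity)
      _ ≤ 32 ^ (1 : ℝ) * (Y / X) ^ r := by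
          gcongr
          · norm_num
          · linarith [hr.2]
      _ = _ := by rw [Real.rpow_one]
  have h3 : D * d ^ (s - m - 1) ≤ D ^ (2 * s - 2 * m - 1) := by
    have : D ^ (2 * s - 2 * m - 1) = D * (D ^ 2) ^ (s - m - 1) := by
      rw [← Real.rpow_natCast, ← Real.rpow_mul hD.le]
      conv_rhs => rw [← Real.rpow_one D, ← Real.rpow_mul hD.le, one_mul]
      rw [← Real.rpow_add hD]
      congr 1
      push_cast
      ring
    rw [this]
    gcongr ?_ * ?_
    exact Real.rpow_le_rpow_of_nonpos (by positivity) hd (by linarith)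
  calc D * (d ^ (s - m - 1) * greenProfile s (m + 1) (a / d))
      = (D * d ^ (s - m - 1)) * greenProfile s (m + 1) (a / d) := by ring
    _ ≤ D ^ (2 * s - 2 * m - 1) * ((1 / s + 1 / (1 - s)) * (32 * (Y / X) ^ r)) := by
        gcongr
        · exact greenProfile_nonneg hz.le
        · refine h1.trans ?_
          gcongr
    _ = _ := by ring

/-- With `M = max X Y` one has `d + a ≥ (M/2)²`, so part of `(d+a)^(-m)` is spent on a power of `D`
and the rest on `M^(1-2s)`. The remaining factor `Y (XY)^(s-1) M^(1-2s)` is `(Y/X)^s` when `Y ≤ X`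
and `(Y/X)^(1-s)` when `Y ≥ X`; these two cases use `r ≤ s` and `1-s ≤ r` respectively. -/
lemma greenProfile_gradient_boundary_le (hs : 1 / 2 < s) (hs1 : s < 1) (hm : 1 / 2 ≤ m)
    (hr : r ∈ Icc (1 - s) s) (hX : 0 < X) (hY : 0 < Y) (hD : 0 < D) (hXY : X - Y ≤ D)
    (hYX : Y - X ≤ D) (hd : D ^ 2 ≤ d) (ha : X * Y ≤ a) :
    Y * (a ^ (s - 1) / (d + a) ^ m) ≤ 2 * ((Y / X) ^ r * D ^ (2 * s - 2 * m - 1)) := by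
  have hd0 : 0 < d := lt_of_lt_of_le (by positivity) hd
  have ha0 : 0 < a := lt_of_lt_of_le (by positivity) ha
  set M := max X Y with hM
  have hM0 : 0 < M := lt_max_of_lt_left hX
  have hMle : (M / 2) ^ 2 ≤ d + a := by
    have h1 := sq_le_four_mul_add hX hXY hd ha ha0.le
    have h2 := sq_le_four_mul_add hY hYX hd (by linarith) ha0.le
    rcases max_choice X Y with h | h <;> rw [hM, h] <;> linarith
  have hsq : ∀ t : ℝ, 0 < t → ∀ e : ℝ, (t ^ 2) ^ e = t ^ (2 * e) := by
    intro t ht e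
    rw [← Real.rpow_natCast, ← Real.rpow_mul ht.le]
    norm_num
  have h1 : a ^ (s - 1) ≤ (X * Y) ^ (s - 1) :=
    Real.rpow_le_rpow_of_nonpos (by positivity) ha (by linarith)
  have h2 : ((d + a) ^ m)⁻¹ ≤ D ^ (2 * s - 2 * m - 1) * (2 * M ^ (1 - 2 * s)) := by
    have e1 : ((d + a) ^ m)⁻¹ = (d + a) ^ (s - m - 1 / 2) * (d + a) ^ (1 / 2 - s) := by
      rw [← Real.rpow_add (by positivity), ← Real.rpow_neg (by positivity)]
      congr 1
      ring
    have e2 : (d + a) ^ (s - m - 1 / 2) ≤ D ^ (2 * s - 2 * m - 1) := by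
      have : D ^ (2 * s - 2 * m - 1) = (D ^ 2) ^ (s - m - 1 / 2) := by
        rw [hsq D hD]
        congr 1
        ring
      rw [this]
      exact Real.rpow_le_rpow_of_nonpos (by positivity) (by linarith) (by linarith)
    have e3 : (d + a) ^ (1 / 2 - s) ≤ 2 * M ^ (1 - 2 * s) := by
      calc (d + a) ^ (1 / 2 - s) ≤ ((M / 2) ^ 2) ^ (1 / 2 - s) :=
            Real.rpow_le_rpow_of_nonpos (by positivity) hMle (by linarith)
        _ = 2 ^ (2 * s - 1) * M ^ (1 - 2 * s) := by
            rw [hsq _ (by positivity), Real.div_rpow hM0.le two_pos.le, div_eq_inv_mul,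
              ← Real.rpow_neg two_pos.le]
            congr 2 <;> ring
        _ ≤ 2 ^ (1 : ℝ) * M ^ (1 - 2 * s) := by
            gcongr
            · norm_num
            · linarith
        _ = _ := by rw [Real.rpow_one]
    rw [e1]
    gcongr
  have h3 : Y * (X * Y) ^ (s - 1) * M ^ (1 - 2 * s) ≤ (Y / X) ^ r := by
    have e1 : Y * (X * Y) ^ (s - 1) = Y ^ s * X ^ (s - 1) := by
      rw [Real.mul_rpow hX.le hY.le, mul_left_comm, Real.rpow_sub_one hY.ne']
      field_simp
    rw [e1]
    rcases le_total Y X with h | h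
    · rw [hM, max_eq_left h, mul_assoc, ← Real.rpow_add hX]
      calc Y ^ s * X ^ (s - 1 + (1 - 2 * s)) = (Y / X) ^ s := by
            rw [Real.div_rpow hY.le hX.le, div_eq_mul_inv, ← Real.rpow_neg hX.le]
            congr 2
            ring
        _ ≤ _ := Real.rpow_le_rpow_of_exponent_ge (by positivity) ((div_le_one hX).2 h) hr.2
    · rw [hM, max_eq_right h, mul_right_comm, ← Real.rpow_add hY]
      calc Y ^ (s + (1 - 2 * s)) * X ^ (s - 1) = (Y / X) ^ (1 - s) := by
            rw [Real.div_rpow hY.le hX.le, div_eq_mul_inv, ← Real.rpow_neg hX.le]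
            congr 2 <;> ring
        _ ≤ _ := Real.rpow_le_rpow_of_exponent_le ((one_le_div hX).2 h) hr.1
  calc Y * (a ^ (s - 1) / (d + a) ^ m)
      = Y * (a ^ (s - 1) * ((d + a) ^ m)⁻¹) := by rw [div_eq_mul_inv]
    _ ≤ Y * ((X * Y) ^ (s - 1) * (D ^ (2 * s - 2 * m - 1) * (2 * M ^ (1 - 2 * s)))) := by gcongr
    _ = 2 * ((Y * (X * Y) ^ (s - 1) * M ^ (1 - 2 * s)) * D ^ (2 * s - 2 * m - 1)) := by ring
    _ ≤ _ := by gcongr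

end Estimates

/-! ### Green's function and its regularizations -/

section Green

open Filter Topology

variable {n : ℕ}

/-- Green's function with `|x - y|²` replaced by `|x - y|² + ε`. -/
noncomputable def greenRegularized (s ε : ℝ) (x y : EuclideanSpace ℝ (Fin n)) : ℝ :=
  greenKappa n s * ((‖x - y‖ ^ 2 + ε) ^ (s - (n : ℝ) / 2) * greenProfile s ((n : ℝ) / 2)
    ((1 - ‖x‖ ^ 2) * (1 - ‖y‖ ^ 2) / (‖x - y‖ ^ 2 + ε)))

/-- The gradient of `greenRegularized s ε x y` in the variable `x`. -/
noncomputable def greenRegularizedGradient (s ε : ℝ) (x y : EuclideanSpace ℝ (Fin n)) :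
    EuclideanSpace ℝ (Fin n) :=
  greenKappa n s •
    (-(2 * (1 - ‖y‖ ^ 2) * (((1 - ‖x‖ ^ 2) * (1 - ‖y‖ ^ 2)) ^ (s - 1) /
        (‖x - y‖ ^ 2 + ε + (1 - ‖x‖ ^ 2) * (1 - ‖y‖ ^ 2)) ^ ((n : ℝ) / 2))) • x -
      (n * ((‖x - y‖ ^ 2 + ε) ^ (s - (n : ℝ) / 2 - 1) * greenProfile s ((n : ℝ) / 2 + 1)
        ((1 - ‖x‖ ^ 2) * (1 - ‖y‖ ^ 2) / (‖x - y‖ ^ 2 + ε)))) • (x - y))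

lemma greenFunction_eq_greenRegularized (s : ℝ) (x y : EuclideanSpace ℝ (Fin n)) :
    greenFunction s x y = greenRegularized s 0 x y := by
  have h : ((‖x - y‖ ^ 2) ^ (s - (n : ℝ) / 2)) = (‖x - y‖ ^ ((n : ℝ) - 2 * s))⁻¹ := by
    rw [← Real.rpow_natCast, ← Real.rpow_mul (norm_nonneg _), ← Real.rpow_neg (norm_nonneg _)]
    congr 1
    push_cast
    ring
  rw [greenFunction, greenRegularized, add_zero, h, div_eq_mul_inv, mul_assoc]
  rfl

lemma mem_unitBall {x : EuclideanSpace ℝ (Fin n)} : x ∈ unitBall n ↔ ‖x‖ < 1 := by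
  simp [unitBall]

lemma greenKappa_pos (hn : 1 ≤ n) {s : ℝ} (hs : 0 < s) : 0 < greenKappa n s := by
  have hn' : (0 : ℝ) < n := by exact_mod_cast hn
  have h1 : 0 < Real.Gamma ((n : ℝ) / 2) := Real.Gamma_pos_of_pos (by positivity)
  have h2 : 0 < Real.Gamma s := Real.Gamma_pos_of_pos hs
  have h3 := Real.pi_pos
  unfold greenKappa
  positivity

lemma one_sub_norm_sq_pos {x : EuclideanSpace ℝ (Fin n)} (hx : x ∈ unitBall n) :
    0 < 1 - ‖x‖ ^ 2 := by
  rw [mem_unitBall] at hx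
  nlinarith [norm_nonneg x]

lemma norm_sq_add_pos {ε : ℝ} (hε : 0 ≤ ε) {x y : EuclideanSpace ℝ (Fin n)}
    (h : x ≠ y ∨ 0 < ε) : 0 < ‖x - y‖ ^ 2 + ε := by
  rcases h with h | h
  · have : 0 < ‖x - y‖ := norm_pos_iff.2 (sub_ne_zero.2 h)
    positivity
  · positivity

lemma rpow_mul_rpow_div_eq {d a s m : ℝ} (hd : 0 < d) (ha : 0 < a) :
    d ^ (s - m - 1) * ((a * d⁻¹) ^ (s - 1) / (1 + a * d⁻¹) ^ m) = a ^ (s - 1) / (d + a) ^ m := by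
  have h1 : 1 + a * d⁻¹ = (d + a) * d⁻¹ := by field_simp
  have h2 : s - m - 1 = (s - 1) - m := by ring
  have hd3 := (Real.rpow_pos_of_pos hd (s - 1)).ne'
  have hd4 := (Real.rpow_pos_of_pos hd m).ne'
  rw [h1, Real.mul_rpow ha.le (by positivity), Real.mul_rpow (by positivity) (by positivity),
    Real.inv_rpow hd.le, Real.inv_rpow hd.le, h2, Real.rpow_sub hd]
  field_simp

/-- With `m = n/2` and `z = a/d`, the chain rule gives `d^(s-m-1) (((s-m)Φ - zΦ')∇d + Φ'∇a)`. The
recurrence rewrites the bracket before `∇d`, and `rpow_mul_rpow_div_eq` simplifies the coefficient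
of `∇a`. -/
lemma hasGradientAt_greenRegularized {s ε : ℝ} (hs : 0 < s) (hε : 0 ≤ ε)
    {x y : EuclideanSpace ℝ (Fin n)} (hx : x ∈ unitBall n) (hy : y ∈ unitBall n)
    (hxy : x ≠ y ∨ 0 < ε) :
    HasGradientAt (fun z => greenRegularized s ε z y) (greenRegularizedGradient s ε x y) x := by
  have hd := norm_sq_add_pos hε hxy
  have hX := one_sub_norm_sq_pos hx
  have hY := one_sub_norm_sq_pos hy
  set d := ‖x - y‖ ^ 2 + ε with hd_def
  set a := (1 - ‖x‖ ^ 2) * (1 - ‖y‖ ^ 2) with ha_def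
  have ha : 0 < a := by positivity
  have hD : HasFDerivAt (fun z : EuclideanSpace ℝ (Fin n) => ‖z - y‖ ^ 2 + ε)
      ((2 : ℝ) • innerSL ℝ (x - y)) x := by
    have := (((hasFDerivAt_id x).sub_const y).norm_sq).add_const ε
    refine this.congr_fderiv ?_
    ext v
    simp
  have hA : HasFDerivAt (fun z : EuclideanSpace ℝ (Fin n) => (1 - ‖z‖ ^ 2) * (1 - ‖y‖ ^ 2))
      ((-2 * (1 - ‖y‖ ^ 2)) • innerSL ℝ x) x := by
    have := (((hasFDerivAt_id x).norm_sq).const_sub 1).mul_const (1 - ‖y‖ ^ 2)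
    refine this.congr_fderiv ?_
    ext v
    simp
    ring
  have hZ := hA.mul ((hasDerivAt_inv hd.ne').comp_hasFDerivAt x hD)
  have hz : 0 < a * d⁻¹ := by positivity
  have hPhi := (hasDerivAt_greenProfile (k := (n : ℝ) / 2) hs hz).comp_hasFDerivAt x hZ
  have hpow := (Real.hasDerivAt_rpow_const (p := s - (n : ℝ) / 2)
    (Or.inl hd.ne')).comp_hasFDerivAt x hD
  have hF := (hpow.mul hPhi).const_mul (greenKappa n s)
  rw [hasGradientAt_iff_hasFDerivAt]
  refine (hF.congr_of_eventuallyEq (Eventually.of_forall fun z => ?_)).congr_fderiv ?_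
  · simp only [greenRegularized, div_eq_mul_inv]
    rfl
  · have hrec := greenProfile_recurrence (k := (n : ℝ) / 2) hs hz
    ext v
    simp only [greenRegularizedGradient, ← hd_def, ← ha_def, div_eq_mul_inv a d]
    simp [← ha_def, ← hd_def]
    have hd1 : d ^ (s - (n : ℝ) / 2) = d ^ (s - (n : ℝ) / 2 - 1) * d := by
      rw [← Real.rpow_add_one hd.ne', sub_add_cancel]
    have hw : d ^ (s - (n : ℝ) / 2 - 1) * ((a * d⁻¹) ^ (s - 1) / (1 + a * d⁻¹) ^ ((n : ℝ) / 2)) =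
        a ^ (s - 1) / (d + a) ^ ((n : ℝ) / 2) := rpow_mul_rpow_div_eq hd ha
    have hi : d * d⁻¹ = 1 := mul_inv_cancel₀ hd.ne'
    rw [hd1, ← inv_pow]
    generalize (a * d⁻¹) ^ (s - 1) / (1 + a * d⁻¹) ^ ((n : ℝ) / 2) = W at *
    generalize a ^ (s - 1) / (d + a) ^ ((n : ℝ) / 2) = A at *
    generalize d ^ (s - (n : ℝ) / 2 - 1) = e at *
    generalize d⁻¹ = i at *
    generalize inner ℝ x v = p at *
    generalize inner ℝ y v = q at *
    -- The recurrence is multiplied by the derivative `2(p-q)` of `d` along `v`, the power identity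
    -- by the derivative of `a`; `hi` clears `d * d⁻¹`.
    linear_combination (greenKappa n s * e * 2 * (p - q)) * hrec -
      (greenKappa n s * 2 * (1 - ‖y‖ ^ 2) * p) * hw -
      (greenKappa n s * e * W * a * i * 2 * (p - q) +
        greenKappa n s * e * W * 2 * (1 - ‖y‖ ^ 2) * p) * hi

lemma unitBall_estimate_hypotheses {x y : EuclideanSpace ℝ (Fin n)} (hx : x ∈ unitBall n)
    (hy : y ∈ unitBall n) : 0 < 1 - ‖x‖ ∧ 0 < 1 - ‖y‖ ∧ (1 - ‖x‖) - (1 - ‖y‖) ≤ ‖x - y‖ ∧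
      (1 - ‖y‖) - (1 - ‖x‖) ≤ ‖x - y‖ ∧
      (1 - ‖x‖) * (1 - ‖y‖) ≤ (1 - ‖x‖ ^ 2) * (1 - ‖y‖ ^ 2) ∧
      (1 - ‖x‖ ^ 2) * (1 - ‖y‖ ^ 2) ≤ 4 * ((1 - ‖x‖) * (1 - ‖y‖)) := by
  rw [mem_unitBall] at hx hy
  have hx0 := norm_nonneg x
  have hy0 := norm_nonneg y
  have e : (1 - ‖x‖ ^ 2) * (1 - ‖y‖ ^ 2) = ((1 - ‖x‖) * (1 - ‖y‖)) * ((1 + ‖x‖) * (1 + ‖y‖)) := by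
    ring
  have hp : 0 ≤ (1 - ‖x‖) * (1 - ‖y‖) := mul_nonneg (by linarith) (by linarith)
  refine ⟨by linarith, by linarith, ?_, ?_, ?_, ?_⟩
  · have := norm_sub_norm_le y x
    rw [norm_sub_rev] at this
    linarith
  · have := norm_sub_norm_le x y
    linarith
  · rw [e]
    exact le_mul_of_one_le_right hp (by nlinarith)
  · rw [e, mul_comm (4 : ℝ)]
    exact mul_le_mul_of_nonneg_left (by nlinarith) hp

lemma greenRegularized_nonneg (hn : 1 ≤ n) {s ε : ℝ} (hs : 0 < s) (hε : 0 ≤ ε)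
    {x y : EuclideanSpace ℝ (Fin n)} (hx : x ∈ unitBall n) (hy : y ∈ unitBall n) :
    0 ≤ greenRegularized s ε x y := by
  have h1 := one_sub_norm_sq_pos hx
  have h2 := one_sub_norm_sq_pos hy
  have := greenKappa_pos hn hs
  have h3 : 0 ≤ greenProfile s ((n : ℝ) / 2)
    ((1 - ‖x‖ ^ 2) * (1 - ‖y‖ ^ 2) / (‖x - y‖ ^ 2 + ε)) := greenProfile_nonneg (by positivity)
  unfold greenRegularized
  positivity

lemma abs_greenRegularized_le (hn : 1 ≤ n) {s : ℝ} (hs : 1 / 2 < s) :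
    ∃ C : ℝ, 0 < C ∧ ∀ ε : ℝ, 0 ≤ ε → ∀ x ∈ unitBall n, ∀ y ∈ unitBall n, x ≠ y →
      |greenRegularized s ε x y| ≤
        C * ((1 - ‖x‖) ^ (s - 1) * (1 - ‖y‖) ^ s * ‖x - y‖ ^ (1 - (n : ℝ))) := by
  have hκ := greenKappa_pos hn (by linarith : 0 < s)
  have hs' : 0 < s - 1 / 2 := by linarith
  have hn' : (1 : ℝ) ≤ n := by exact_mod_cast hn
  refine ⟨greenKappa n s * (1 / (s - 1 / 2) * 4 ^ (s - 1 / 2) * 32 ^ (1 / 2 : ℝ)), by positivity,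
    fun ε hε x hx y hy hxy => ?_⟩
  obtain ⟨hX, hY, h1, -, h3, h4⟩ := unitBall_estimate_hypotheses hx hy
  rw [abs_of_nonneg (greenRegularized_nonneg hn (by linarith) hε hx hy), mul_assoc]
  unfold greenRegularized
  refine mul_le_mul_of_nonneg_left ?_ hκ.le
  have := greenProfile_term_le (m := (n : ℝ) / 2) (d := ‖x - y‖ ^ 2 + ε) hs (by linarith) hX hY
    (norm_pos_iff.2 (sub_ne_zero.2 hxy)) h1 (by linarith) h3 h4
  rwa [mul_div_cancel₀ _ (two_ne_zero' ℝ)] at this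

/-- One constant serves all `r` and all `ε ≥ 0`: the case `ε = 0` is the bound for `∇G`, and
uniformity in `ε` provides the dominating function for the limit. -/
lemma norm_greenRegularizedGradient_le (hn : 1 ≤ n) {s : ℝ} (hs : 1 / 2 < s) (hs1 : s < 1) :
    ∃ C : ℝ, 0 < C ∧ ∀ r ∈ Icc (1 - s) s, ∀ ε : ℝ, 0 ≤ ε → ∀ x ∈ unitBall n, ∀ y ∈ unitBall n,
      x ≠ y → ‖greenRegularizedGradient s ε x y‖ ≤
        C * (((1 - ‖y‖) / (1 - ‖x‖)) ^ r * ‖x - y‖ ^ (-((n : ℝ) - (2 * s - 1)))) := by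
  have hκ := greenKappa_pos hn (by linarith : 0 < s)
  have hs' : 0 < 1 - s := by linarith
  have hn' : (1 : ℝ) ≤ n := by exact_mod_cast hn
  -- The 8 is the product of the prefactor 2, of `1-|y|² ≤ 2(1-|y|)` and of the constant 2 in the
  -- boundary estimate.
  refine ⟨greenKappa n s * (8 + n * ((1 / s + 1 / (1 - s)) * 32)), by positivity,
    fun r hr ε hε x hx y hy hxy => ?_⟩
  obtain ⟨hX, hY, h1, h2, h3, h4⟩ := unitBall_estimate_hypotheses hx hy
  have hD : 0 < ‖x - y‖ := norm_pos_iff.2 (sub_ne_zero.2 hxy)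
  have b1 := greenProfile_gradient_radial_le (m := (n : ℝ) / 2) (d := ‖x - y‖ ^ 2 + ε) hs hs1
    (by linarith) hr hX hY hD h1 (by linarith) h3 h4
  have b2 := greenProfile_gradient_boundary_le (m := (n : ℝ) / 2) (d := ‖x - y‖ ^ 2 + ε) hs hs1
    (by linarith) hr hX hY hD h1 h2 (by linarith) h3
  have hexp : 2 * s - 2 * ((n : ℝ) / 2) - 1 = -((n : ℝ) - (2 * s - 1)) := by ring
  rw [hexp] at b1 b2
  set Q := ((1 - ‖y‖) / (1 - ‖x‖)) ^ r * ‖x - y‖ ^ (-((n : ℝ) - (2 * s - 1)))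
  have hx1 : ‖x‖ ≤ 1 := by linarith
  have ha0 : 0 < (1 - ‖x‖ ^ 2) * (1 - ‖y‖ ^ 2) :=
    mul_pos (one_sub_norm_sq_pos hx) (one_sub_norm_sq_pos hy)
  set a := (1 - ‖x‖ ^ 2) * (1 - ‖y‖ ^ 2)
  have hd0 : 0 < ‖x - y‖ ^ 2 + ε := by positivity
  set d := ‖x - y‖ ^ 2 + ε
  unfold greenRegularizedGradient
  rw [norm_smul, Real.norm_of_nonneg hκ.le, mul_assoc (greenKappa n s)]
  refine mul_le_mul_of_nonneg_left ?_ hκ.le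
  refine (norm_sub_le _ _).trans ?_
  rw [norm_smul, norm_smul, Real.norm_eq_abs, Real.norm_eq_abs, abs_neg, add_mul]
  have hP : 0 ≤ greenProfile s ((n : ℝ) / 2 + 1) (a / d) := greenProfile_nonneg (by positivity)
  have hY2 : 0 < 1 - ‖y‖ ^ 2 := one_sub_norm_sq_pos hy
  rw [abs_of_nonneg (by positivity), abs_of_nonneg (by positivity)]
  have hY3 : 1 - ‖y‖ ^ 2 ≤ 2 * (1 - ‖y‖) := by nlinarith
  gcongr ?_ + ?_
  · calc _ ≤ 2 * (2 * (1 - ‖y‖)) * (a ^ (s - 1) / (d + a) ^ ((n : ℝ) / 2)) * 1 := by gcongr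
      _ = 4 * ((1 - ‖y‖) * (a ^ (s - 1) / (d + a) ^ ((n : ℝ) / 2))) := by ring
      _ ≤ 4 * (2 * Q) := by gcongr
      _ = _ := by ring
  · calc _ = n * (‖x - y‖ * (d ^ (s - (n : ℝ) / 2 - 1) *
          greenProfile s ((n : ℝ) / 2 + 1) (a / d))) := by ring
      _ ≤ n * ((1 / s + 1 / (1 - s)) * 32 * Q) := by gcongr
      _ = _ := by ring

/-! ### Limit of the regularization and joint measurability -/

lemma continuousAt_greenProfile {s k z : ℝ} (hs : 0 < s) (hz : 0 < z) :
    ContinuousAt (greenProfile s k) z := (hasDerivAt_greenProfile hs hz).continuousAt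

lemma tendsto_greenRegularized {s : ℝ} (hs : 0 < s) {x y : EuclideanSpace ℝ (Fin n)}
    (hx : x ∈ unitBall n) (hy : y ∈ unitBall n) (hxy : x ≠ y) :
    Tendsto (fun ε => greenRegularized s ε x y) (𝓝 0) (𝓝 (greenRegularized s 0 x y)) := by
  have hd := norm_sq_add_pos le_rfl (Or.inl hxy : x ≠ y ∨ (0 : ℝ) < 0)
  have ha := mul_pos (one_sub_norm_sq_pos hx) (one_sub_norm_sq_pos hy)
  change ContinuousAt (fun ε => greenRegularized s ε x y) 0
  unfold greenRegularized
  have c1 : ContinuousAt (fun ε : ℝ => ‖x - y‖ ^ 2 + ε) 0 := by fun_prop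
  refine continuousAt_const.mul ((c1.rpow_const (Or.inl hd.ne')).mul ?_)
  exact ContinuousAt.comp (f := fun ε : ℝ => (1 - ‖x‖ ^ 2) * (1 - ‖y‖ ^ 2) / (‖x - y‖ ^ 2 + ε))
    (continuousAt_greenProfile hs (div_pos ha hd)) (continuousAt_const.div c1 hd.ne')

lemma tendsto_greenRegularizedGradient {s : ℝ} (hs : 0 < s) {x y : EuclideanSpace ℝ (Fin n)}
    (hx : x ∈ unitBall n) (hy : y ∈ unitBall n) (hxy : x ≠ y) :
    Tendsto (fun ε => greenRegularizedGradient s ε x y) (𝓝 0)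
      (𝓝 (greenRegularizedGradient s 0 x y)) := by
  have hd := norm_sq_add_pos le_rfl (Or.inl hxy : x ≠ y ∨ (0 : ℝ) < 0)
  have ha := mul_pos (one_sub_norm_sq_pos hx) (one_sub_norm_sq_pos hy)
  change ContinuousAt (fun ε => greenRegularizedGradient s ε x y) 0
  unfold greenRegularizedGradient
  have c1 : ContinuousAt (fun ε : ℝ => ‖x - y‖ ^ 2 + ε) 0 := by fun_prop
  have hda := add_pos hd ha
  have c2 : ContinuousAt (fun ε : ℝ => (‖x - y‖ ^ 2 + ε +
      (1 - ‖x‖ ^ 2) * (1 - ‖y‖ ^ 2)) ^ ((n : ℝ) / 2)) 0 :=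
    (c1.add continuousAt_const).rpow_const (Or.inl (by simpa using hda.ne'))
  have c3 : ContinuousAt (fun ε : ℝ => greenProfile s ((n : ℝ) / 2 + 1)
      ((1 - ‖x‖ ^ 2) * (1 - ‖y‖ ^ 2) / (‖x - y‖ ^ 2 + ε))) 0 :=
    ContinuousAt.comp (f := fun ε : ℝ => (1 - ‖x‖ ^ 2) * (1 - ‖y‖ ^ 2) / (‖x - y‖ ^ 2 + ε))
      (continuousAt_greenProfile hs (div_pos ha hd)) (continuousAt_const.div c1 hd.ne')
  have c4 : ContinuousAt (fun ε : ℝ => (‖x - y‖ ^ 2 + ε) ^ (s - (n : ℝ) / 2 - 1)) 0 :=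
    c1.rpow_const (Or.inl hd.ne')
  have c5 : ContinuousAt (fun ε : ℝ => ((1 - ‖x‖ ^ 2) * (1 - ‖y‖ ^ 2)) ^ (s - 1) /
      (‖x - y‖ ^ 2 + ε + (1 - ‖x‖ ^ 2) * (1 - ‖y‖ ^ 2)) ^ ((n : ℝ) / 2)) 0 :=
    continuousAt_const.div c2 (Real.rpow_pos_of_pos (by simpa using hda) _).ne'
  fun_prop

lemma greenProfile_eq_indicator {s k z : ℝ} (hz : 0 ≤ z) :
    greenProfile s k z = (Ioi (0 : ℝ)).indicator (greenProfile s k) z := by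
  rcases hz.eq_or_lt with rfl | hz
  · simp [greenProfile_zero]
  · rw [indicator_of_mem (by exact hz)]

/-- Cutting the profile off at nonpositive arguments makes it Borel, and inside the ball its
argument is never negative. -/
lemma exists_measurable_greenRegularized {s ε : ℝ} (hs : 0 < s) (hε : 0 ≤ ε) :
    ∃ G : EuclideanSpace ℝ (Fin n) × EuclideanSpace ℝ (Fin n) → ℝ, Measurable G ∧
      ∀ x ∈ unitBall n, ∀ y ∈ unitBall n, greenRegularized s ε x y = G (x, y) := by
  have hm := measurable_indicator_greenProfile (k := (n : ℝ) / 2) hs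
  refine ⟨fun z => greenKappa n s * ((‖z.1 - z.2‖ ^ 2 + ε) ^ (s - (n : ℝ) / 2) *
    (Ioi (0 : ℝ)).indicator (greenProfile s ((n : ℝ) / 2))
    ((1 - ‖z.1‖ ^ 2) * (1 - ‖z.2‖ ^ 2) / (‖z.1 - z.2‖ ^ 2 + ε))), ?_, fun x hx y hy => ?_⟩
  · have : Measurable fun z : EuclideanSpace ℝ (Fin n) × EuclideanSpace ℝ (Fin n) =>
        (1 - ‖z.1‖ ^ 2) * (1 - ‖z.2‖ ^ 2) / (‖z.1 - z.2‖ ^ 2 + ε) := by fun_prop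
    have h2 := hm.comp this
    exact measurable_const.mul ((by fun_prop : Measurable fun z : EuclideanSpace ℝ (Fin n) ×
      EuclideanSpace ℝ (Fin n) => (‖z.1 - z.2‖ ^ 2 + ε) ^ (s - (n : ℝ) / 2)).mul h2)
  · have h1 := one_sub_norm_sq_pos hx
    have h2 := one_sub_norm_sq_pos hy
    rw [greenRegularized, greenProfile_eq_indicator (by positivity)]

lemma exists_measurable_greenRegularizedGradient {s ε : ℝ} (hs : 0 < s) (hε : 0 ≤ ε) :
    ∃ G : EuclideanSpace ℝ (Fin n) × EuclideanSpace ℝ (Fin n) → EuclideanSpace ℝ (Fin n),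
      Measurable G ∧
      ∀ x ∈ unitBall n, ∀ y ∈ unitBall n, greenRegularizedGradient s ε x y = G (x, y) := by
  have hm := measurable_indicator_greenProfile (k := (n : ℝ) / 2 + 1) hs
  refine ⟨fun z => greenKappa n s •
    (-(2 * (1 - ‖z.2‖ ^ 2) * (((1 - ‖z.1‖ ^ 2) * (1 - ‖z.2‖ ^ 2)) ^ (s - 1) /
        (‖z.1 - z.2‖ ^ 2 + ε + (1 - ‖z.1‖ ^ 2) * (1 - ‖z.2‖ ^ 2)) ^ ((n : ℝ) / 2))) • z.1 -
      (n * ((‖z.1 - z.2‖ ^ 2 + ε) ^ (s - (n : ℝ) / 2 - 1) *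
        (Ioi (0 : ℝ)).indicator (greenProfile s ((n : ℝ) / 2 + 1))
        ((1 - ‖z.1‖ ^ 2) * (1 - ‖z.2‖ ^ 2) / (‖z.1 - z.2‖ ^ 2 + ε)))) • (z.1 - z.2)),
    ?_, fun x hx y hy => ?_⟩
  · have : Measurable fun z : EuclideanSpace ℝ (Fin n) × EuclideanSpace ℝ (Fin n) =>
        (1 - ‖z.1‖ ^ 2) * (1 - ‖z.2‖ ^ 2) / (‖z.1 - z.2‖ ^ 2 + ε) := by fun_prop
    have h2 := hm.comp this
    simp only [Function.comp_def] at h2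
    fun_prop
  · have h1 := one_sub_norm_sq_pos hx
    have h2 := one_sub_norm_sq_pos hy
    rw [greenRegularizedGradient, greenProfile_eq_indicator (by positivity)]

/-- The gradient of Green's function is bounded by a weighted Riesz kernel. -/
lemma norm_gradient_greenFunction_le (hn : 1 ≤ n) {s : ℝ} (hs : 1 / 2 < s) (hs1 : s < 1) :
    ∃ C : ℝ, 0 < C ∧ ∀ r ∈ Icc (1 - s) s,
      ∀ x ∈ unitBall n, ∀ y ∈ unitBall n, x ≠ y →
        DifferentiableAt ℝ (fun z => greenFunction s z y) x ∧
        ‖gradient (fun z => greenFunction s z y) x‖ * (1 - ‖x‖) ^ r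
          ≤ C * (1 - ‖y‖) ^ r / ‖x - y‖ ^ ((n : ℝ) - 2 * s + 1) := by
  obtain ⟨C, hC, h⟩ := norm_greenRegularizedGradient_le hn hs hs1
  refine ⟨C, hC, fun r hr x hx y hy hxy => ?_⟩
  have hg : HasGradientAt (fun z => greenFunction s z y) (greenRegularizedGradient s 0 x y) x := by
    simp_rw [greenFunction_eq_greenRegularized]
    exact hasGradientAt_greenRegularized (by linarith) le_rfl hx hy (Or.inl hxy)
  refine ⟨hg.differentiableAt, ?_⟩
  rw [hg.gradient]
  have h1 := h r hr 0 le_rfl x hx y hy hxy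
  obtain ⟨hX, hY, -⟩ := unitBall_estimate_hypotheses hx hy
  refine (mul_le_mul_of_nonneg_right h1 (by positivity)).trans (le_of_eq ?_)
  have hexp : (n : ℝ) - 2 * s + 1 = (n : ℝ) - (2 * s - 1) := by ring
  rw [hexp, Real.rpow_neg (norm_nonneg _), Real.div_rpow hY.le hX.le]
  have := Real.rpow_pos_of_pos hX r
  field_simp

end Green

/-! ### Integrability of Green's function against weighted data -/

section Integrability

open Filter Topology

variable {n : ℕ}

/-- Lebesgue measure on the unit ball. -/
noncomputable abbrev ballVolume (n : ℕ) : Measure (EuclideanSpace ℝ (Fin n)) :=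
  volume.restrict (unitBall n)

lemma measurableSet_unitBall : MeasurableSet (unitBall n) := measurableSet_ball

instance isFiniteMeasure_ballVolume : IsFiniteMeasure (ballVolume n) :=
  ⟨by simpa [unitBall] using (measure_ball_lt_top (x := (0 : EuclideanSpace ℝ (Fin n))) (r := 1))⟩

lemma nontrivial_euclideanSpace_fin (hn : 1 ≤ n) : Nontrivial (EuclideanSpace ℝ (Fin n)) :=
  Module.nontrivial_of_finrank_pos (R := ℝ) (by rw [finrank_euclideanSpace_fin]; omega)

lemma ae_ballVolume_mem : ∀ᵐ x ∂ballVolume n, x ∈ unitBall n :=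
  ae_restrict_mem measurableSet_unitBall

lemma ae_ballVolume_prod_mem :
    ∀ᵐ z ∂(ballVolume n).prod (ballVolume n), z.1 ∈ unitBall n ∧ z.2 ∈ unitBall n := by
  rw [ballVolume, Measure.prod_restrict]
  filter_upwards [ae_restrict_mem (measurableSet_unitBall.prod measurableSet_unitBall)] with z hz
  exact hz

lemma ae_ballVolume_ne (hn : 1 ≤ n) (y : EuclideanSpace ℝ (Fin n)) :
    ∀ᵐ x ∂ballVolume n, x ≠ y := by
  have := nontrivial_euclideanSpace_fin hn
  refine ae_restrict_of_ae ?_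
  rw [ae_iff]
  simp

lemma exists_lintegral_norm_sub_rpow_le (hn : 1 ≤ n) {b : ℝ} (hb : b < n) :
    ∃ C : ℝ≥0∞, C ≠ ⊤ ∧ ∀ y ∈ unitBall n,
      ∫⁻ x, ENNReal.ofReal (‖x - y‖ ^ (-b)) ∂ballVolume n ≤ C := by
  have := nontrivial_euclideanSpace_fin hn
  obtain ⟨C, hC, h⟩ := exists_lintegral_ball_norm_rpow_le
    (volume : Measure (EuclideanSpace ℝ (Fin n))) (b := b) (by simpa using hb)
  refine ⟨C, hC, fun y hy => ?_⟩
  simp_rw [fun x => norm_sub_rev x y]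
  exact h y hy

lemma integrable_norm_sub_rpow_neg (hn : 1 ≤ n) {b : ℝ} (hb : b < n)
    {y : EuclideanSpace ℝ (Fin n)} (hy : y ∈ unitBall n) :
    Integrable (fun x => ‖x - y‖ ^ (-b)) (ballVolume n) := by
  obtain ⟨C, hC, h⟩ := exists_lintegral_norm_sub_rpow_le hn hb
  refine ⟨(by fun_prop : Measurable fun x => ‖x - y‖ ^ (-b)).aestronglyMeasurable, ?_⟩
  rw [hasFiniteIntegral_iff_norm]
  refine lt_of_le_of_lt (le_of_eq (lintegral_congr fun x => ?_)) ((h y hy).trans_lt hC.lt_top)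
  rw [Real.norm_of_nonneg (by positivity)]

/-- The `x`-integral of the kernel is bounded uniformly in `y`, so integrability of `h` suffices. -/
lemma integrable_prod_of_kernel_bound (hn : 1 ≤ n) {b : ℝ} (hb : b < n) {F : Type*}
    [NormedAddCommGroup F] [NormedSpace ℝ F] {h : EuclideanSpace ℝ (Fin n) → ℝ}
    (hh : Integrable h (ballVolume n))
    {k : EuclideanSpace ℝ (Fin n) → EuclideanSpace ℝ (Fin n) → F}
    (hk : AEStronglyMeasurable (Function.uncurry k) ((ballVolume n).prod (ballVolume n))) {C : ℝ}
    (hC : ∀ x ∈ unitBall n, ∀ y ∈ unitBall n, x ≠ y → ‖k x y‖ ≤ C * ‖x - y‖ ^ (-b)) :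
    Integrable (fun z => h z.2 • k z.1 z.2) ((ballVolume n).prod (ballVolume n)) := by
  obtain ⟨A, hA, hAle⟩ := exists_lintegral_norm_sub_rpow_le hn hb
  have hm : AEStronglyMeasurable (fun z : EuclideanSpace ℝ (Fin n) × EuclideanSpace ℝ (Fin n) =>
      h z.2 • k z.1 z.2) ((ballVolume n).prod (ballVolume n)) :=
    (hh.aestronglyMeasurable.comp_snd).smul hk
  refine ⟨hm, ?_⟩
  rw [hasFiniteIntegral_iff_enorm, lintegral_prod_symm _ hm.enorm]
  calc ∫⁻ y, ∫⁻ x, ‖h y • k x y‖ₑ ∂ballVolume n ∂ballVolume n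
      ≤ ∫⁻ y, ‖h y‖ₑ * (ENNReal.ofReal C * A) ∂ballVolume n := by
        refine lintegral_mono_ae ?_
        filter_upwards [ae_ballVolume_mem] with y hy
        calc ∫⁻ x, ‖h y • k x y‖ₑ ∂ballVolume n
            ≤ ∫⁻ x, (‖h y‖ₑ * ENNReal.ofReal C) * ENNReal.ofReal (‖x - y‖ ^ (-b)) ∂ballVolume n := by
              refine lintegral_mono_ae ?_
              filter_upwards [ae_ballVolume_mem, ae_ballVolume_ne hn y] with x hx hxy
              rw [enorm_smul, mul_assoc, ← ENNReal.ofReal_mul' (by positivity)]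
              gcongr
              rw [← ofReal_norm]
              exact ENNReal.ofReal_le_ofReal (hC x hx y hy hxy)
          _ ≤ _ := by
              rw [lintegral_const_mul _ (by fun_prop), mul_assoc]
              gcongr
              exact hAle y hy
    _ < ⊤ := by
        rw [lintegral_mul_const' _ _ (by finiteness)]
        exact ENNReal.mul_lt_top hh.hasFiniteIntegral (by finiteness)

lemma aestronglyMeasurable_greenRegularized {s ε : ℝ} (hs : 0 < s) (hε : 0 ≤ ε) :
    AEStronglyMeasurable (Function.uncurry (greenRegularized (n := n) s ε))
      ((ballVolume n).prod (ballVolume n)) := by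
  obtain ⟨G, hG, h⟩ := exists_measurable_greenRegularized (n := n) hs hε
  refine hG.aestronglyMeasurable.congr ?_
  filter_upwards [ae_ballVolume_prod_mem] with z hz
  exact (h _ hz.1 _ hz.2).symm

lemma aestronglyMeasurable_greenRegularizedGradient {s ε : ℝ} (hs : 0 < s) (hε : 0 ≤ ε) :
    AEStronglyMeasurable (Function.uncurry (greenRegularizedGradient (n := n) s ε))
      ((ballVolume n).prod (ballVolume n)) := by
  obtain ⟨G, hG, h⟩ := exists_measurable_greenRegularizedGradient (n := n) hs hε
  refine hG.aestronglyMeasurable.congr ?_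
  filter_upwards [ae_ballVolume_prod_mem] with z hz
  exact (h _ hz.1 _ hz.2).symm

lemma aestronglyMeasurable_greenRegularized_left {s ε : ℝ} (hs : 0 < s) (hε : 0 ≤ ε)
    {y : EuclideanSpace ℝ (Fin n)} (hy : y ∈ unitBall n) :
    AEStronglyMeasurable (fun x => greenRegularized s ε x y) (ballVolume n) := by
  obtain ⟨G, hG, h⟩ := exists_measurable_greenRegularized (n := n) hs hε
  refine (hG.comp (measurable_prodMk_right (y := y))).aestronglyMeasurable.congr ?_
  filter_upwards [ae_ballVolume_mem] with x hx
  exact (h _ hx _ hy).symm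

lemma aestronglyMeasurable_greenRegularizedGradient_left {s ε : ℝ} (hs : 0 < s) (hε : 0 ≤ ε)
    {y : EuclideanSpace ℝ (Fin n)} (hy : y ∈ unitBall n) :
    AEStronglyMeasurable (fun x => greenRegularizedGradient s ε x y) (ballVolume n) := by
  obtain ⟨G, hG, h⟩ := exists_measurable_greenRegularizedGradient (n := n) hs hε
  refine (hG.comp (measurable_prodMk_right (y := y))).aestronglyMeasurable.congr ?_
  filter_upwards [ae_ballVolume_mem] with x hx
  exact (h _ hx _ hy).symm

lemma one_sub_norm_pos {x : EuclideanSpace ℝ (Fin n)} (hx : x ∈ unitBall n) : 0 < 1 - ‖x‖ := by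
  rw [mem_unitBall] at hx
  linarith

/-- The weight in `x` cancels the factor `(1-|x|)^(s-1)` in the bound for `G`; moving the weight of
`f` onto the kernel leaves `(1-|y|)^(s-r) ≤ 1`. -/
lemma integrable_weighted_greenRegularized (hn : 1 ≤ n) {s r : ℝ} (hs : 1 / 2 < s) (hr : r ≤ s)
    {f : EuclideanSpace ℝ (Fin n) → ℝ}
    (hf : Integrable (fun y => (1 - ‖y‖) ^ r * f y) (ballVolume n)) :
    Integrable (fun z => (1 - ‖z.1‖) ^ (1 - s) * (f z.2 * greenRegularized s 0 z.1 z.2))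
      ((ballVolume n).prod (ballVolume n)) := by
  obtain ⟨C, hC, h⟩ := abs_greenRegularized_le hn hs
  have hn' : (1 : ℝ) ≤ n := by exact_mod_cast hn
  have key := integrable_prod_of_kernel_bound hn (b := n - 1) (by linarith) hf
    (k := fun x y => (1 - ‖x‖) ^ (1 - s) * ((1 - ‖y‖) ^ (-r) * greenRegularized s 0 x y))
    (((by fun_prop : Measurable fun z : EuclideanSpace ℝ (Fin n) × EuclideanSpace ℝ (Fin n) =>
      (1 - ‖z.1‖) ^ (1 - s)).aestronglyMeasurable).mul
      (((by fun_prop : Measurable fun z : EuclideanSpace ℝ (Fin n) × EuclideanSpace ℝ (Fin n) =>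
      (1 - ‖z.2‖) ^ (-r)).aestronglyMeasurable).mul
      (aestronglyMeasurable_greenRegularized (by linarith) le_rfl))) (C := C) ?_
  · refine key.congr ?_
    filter_upwards [ae_ballVolume_prod_mem] with z hz
    have hY := one_sub_norm_pos hz.2
    have hYr := (Real.rpow_pos_of_pos hY r).ne'
    rw [smul_eq_mul, Real.rpow_neg hY.le]
    field_simp
  · intro x hx y hy hxy
    have hX := one_sub_norm_pos hx
    have hY := one_sub_norm_pos hy
    rw [Real.norm_eq_abs, abs_mul, abs_mul, abs_of_pos (Real.rpow_pos_of_pos hX _),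
      abs_of_pos (Real.rpow_pos_of_pos hY _)]
    have e1 : (1 - ‖x‖) ^ (1 - s) * (1 - ‖x‖) ^ (s - 1) = 1 := by
      rw [← Real.rpow_add hX]; simp
    have e2 : (1 - ‖y‖) ^ (-r) * (1 - ‖y‖) ^ s ≤ 1 := by
      rw [← Real.rpow_add hY]
      exact Real.rpow_le_one hY.le (by linarith [norm_nonneg y]) (by linarith)
    calc _ ≤ (1 - ‖x‖) ^ (1 - s) * ((1 - ‖y‖) ^ (-r) * (C * ((1 - ‖x‖) ^ (s - 1) *
          (1 - ‖y‖) ^ s * ‖x - y‖ ^ (1 - (n : ℝ))))) := by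
          gcongr
          exact h 0 le_rfl x hx y hy hxy
      _ = ((1 - ‖x‖) ^ (1 - s) * (1 - ‖x‖) ^ (s - 1)) * ((1 - ‖y‖) ^ (-r) * (1 - ‖y‖) ^ s) *
          (C * ‖x - y‖ ^ (1 - (n : ℝ))) := by ring
      _ ≤ 1 * 1 * (C * ‖x - y‖ ^ (1 - (n : ℝ))) := by
          rw [e1]
          gcongr
      _ = _ := by rw [neg_sub]; ring

lemma integrable_weighted_greenRegularizedGradient (hn : 1 ≤ n) {s r : ℝ} (hs : 1 / 2 < s)
    (hs1 : s < 1) (hr : r ∈ Icc (1 - s) s) {f : EuclideanSpace ℝ (Fin n) → ℝ}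
    (hf : Integrable (fun y => (1 - ‖y‖) ^ r * f y) (ballVolume n)) :
    Integrable (fun z => (1 - ‖z.1‖) ^ r • (f z.2 • greenRegularizedGradient s 0 z.1 z.2))
      ((ballVolume n).prod (ballVolume n)) := by
  obtain ⟨C, hC, h⟩ := norm_greenRegularizedGradient_le hn hs hs1
  have key := integrable_prod_of_kernel_bound hn (b := n - (2 * s - 1)) (by linarith) hf
    (k := fun x y => (1 - ‖x‖) ^ r • ((1 - ‖y‖) ^ (-r) • greenRegularizedGradient s 0 x y))
    (((by fun_prop : Measurable fun z : EuclideanSpace ℝ (Fin n) × EuclideanSpace ℝ (Fin n) =>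
      (1 - ‖z.1‖) ^ r).aestronglyMeasurable).smul
      (((by fun_prop : Measurable fun z : EuclideanSpace ℝ (Fin n) × EuclideanSpace ℝ (Fin n) =>
      (1 - ‖z.2‖) ^ (-r)).aestronglyMeasurable).smul
      (aestronglyMeasurable_greenRegularizedGradient (by linarith) le_rfl))) (C := C) ?_
  · refine key.congr ?_
    filter_upwards [ae_ballVolume_prod_mem] with z hz
    have hY := one_sub_norm_pos hz.2
    have hYr := (Real.rpow_pos_of_pos hY r).ne'
    simp only [smul_smul]
    rw [Real.rpow_neg hY.le]
    congr 1
    field_simp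
  · intro x hx y hy hxy
    have hX := one_sub_norm_pos hx
    have hY := one_sub_norm_pos hy
    have hXr := Real.rpow_pos_of_pos hX r
    have hYr := Real.rpow_pos_of_pos hY r
    rw [norm_smul, norm_smul, Real.norm_of_nonneg (by positivity),
      Real.norm_of_nonneg (by positivity)]
    calc _ ≤ (1 - ‖x‖) ^ r * ((1 - ‖y‖) ^ (-r) * (C * (((1 - ‖y‖) / (1 - ‖x‖)) ^ r *
          ‖x - y‖ ^ (-((n : ℝ) - (2 * s - 1)))))) := by
          gcongr
          exact h r hr 0 le_rfl x hx y hy hxy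
      _ = _ := by
          rw [Real.div_rpow hY.le hX.le, Real.rpow_neg hY.le]
          field_simp

/-- The support stays away from the sphere, so `ψ` absorbs any power of the boundary distance in the
kernel bounds. -/
lemma abs_le_mul_of_tsupport_subset_unitBall {ψ : EuclideanSpace ℝ (Fin n) → ℝ}
    (hψ : Continuous ψ) (hc : HasCompactSupport ψ) (hsub : tsupport ψ ⊆ unitBall n) (t : ℝ) :
    ∃ C : ℝ, 0 ≤ C ∧ ∀ x ∈ unitBall n, |ψ x| ≤ C * (1 - ‖x‖) ^ t := by
  have hcont : ContinuousOn (fun x => ψ x * (1 - ‖x‖) ^ (-t)) (tsupport ψ) := by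
    refine hψ.continuousOn.mul (ContinuousOn.rpow_const (by fun_prop) fun x hx => Or.inl ?_)
    exact (one_sub_norm_pos (hsub hx)).ne'
  obtain ⟨C, hC⟩ := hc.isCompact.exists_bound_of_continuousOn hcont
  refine ⟨max C 0, le_max_right _ _, fun x hx => ?_⟩
  have hX := one_sub_norm_pos hx
  have hXt := Real.rpow_pos_of_pos hX t
  by_cases h : x ∈ tsupport ψ
  · have := (hC x h).trans (le_max_left C 0)
    rw [Real.norm_eq_abs, abs_mul, abs_of_pos (Real.rpow_pos_of_pos hX _), Real.rpow_neg hX.le,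
      ← div_eq_mul_inv, div_le_iff₀ hXt] at this
    exact this
  · rw [image_eq_zero_of_notMem_tsupport h, abs_zero]
    positivity

lemma locallyIntegrableOn_unitBall_of_weighted {F : Type*} [NormedAddCommGroup F]
    [NormedSpace ℝ F] {u : EuclideanSpace ℝ (Fin n) → F} {t : ℝ}
    (hu : Integrable (fun x => (1 - ‖x‖) ^ t • u x) (ballVolume n)) :
    LocallyIntegrableOn u (unitBall n) volume := by
  have h1 : LocallyIntegrableOn (fun x => (1 - ‖x‖) ^ t • u x) (unitBall n) volume :=
    IntegrableOn.locallyIntegrableOn hu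
  have hB : IsLocallyClosed (unitBall n) := isOpen_ball.isLocallyClosed
  have hc : ContinuousOn (fun x : EuclideanSpace ℝ (Fin n) => (1 - ‖x‖) ^ (-t)) (unitBall n) :=
    ContinuousOn.rpow_const (by fun_prop) fun x hx => Or.inl (one_sub_norm_pos hx).ne'
  have h2 := h1.continuousOn_smul hB hc
  rw [locallyIntegrableOn_iff hB] at h2 ⊢
  intro K hK hKc
  refine (h2 K hK hKc).congr_fun (fun x hx => ?_) hKc.measurableSet
  have hX := one_sub_norm_pos (hK hx)
  dsimp only
  rw [smul_smul, ← Real.rpow_add hX]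
  simp

end Integrability

/-! ### The weak gradient of Green's potential -/

section WeakGradient

open Filter Topology

variable {n : ℕ}

lemma exists_abs_greenRegularized_mul_le (hn : 1 ≤ n) {s : ℝ} (hs : 1 / 2 < s)
    {ψ : EuclideanSpace ℝ (Fin n) → ℝ} (hψ : Continuous ψ) (hc : HasCompactSupport ψ)
    (hsub : tsupport ψ ⊆ unitBall n) :
    ∃ C : ℝ, ∀ ε : ℝ, 0 ≤ ε → ∀ x ∈ unitBall n, ∀ y ∈ unitBall n, x ≠ y →
      ‖greenRegularized s ε x y * ψ x‖ ≤ C * ‖x - y‖ ^ (-((n : ℝ) - 1)) := by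
  obtain ⟨A, hA, h⟩ := abs_greenRegularized_le hn hs
  obtain ⟨B, hB, hψB⟩ := abs_le_mul_of_tsupport_subset_unitBall hψ hc hsub (1 - s)
  refine ⟨A * B, fun ε hε x hx y hy hxy => ?_⟩
  have hX := one_sub_norm_pos hx
  have hY := one_sub_norm_pos hy
  have e1 : (1 - ‖x‖) ^ (s - 1) * (1 - ‖x‖) ^ (1 - s) = 1 := by
    rw [← Real.rpow_add hX]; simp
  have e2 : (1 - ‖y‖) ^ s ≤ 1 :=
    Real.rpow_le_one hY.le (by linarith [norm_nonneg y]) (by linarith)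
  rw [Real.norm_eq_abs, abs_mul, neg_sub]
  calc _ ≤ A * ((1 - ‖x‖) ^ (s - 1) * (1 - ‖y‖) ^ s * ‖x - y‖ ^ (1 - (n : ℝ))) *
        (B * (1 - ‖x‖) ^ (1 - s)) :=
        mul_le_mul (h ε hε x hx y hy hxy) (hψB x hx) (abs_nonneg _) (by positivity)
    _ = A * B * (((1 - ‖x‖) ^ (s - 1) * (1 - ‖x‖) ^ (1 - s)) * (1 - ‖y‖) ^ s *
          ‖x - y‖ ^ (1 - (n : ℝ))) := by ring
    _ ≤ A * B * (1 * 1 * ‖x - y‖ ^ (1 - (n : ℝ))) := by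
        rw [e1]
        gcongr
    _ = _ := by ring

lemma exists_abs_inner_greenRegularizedGradient_mul_le (hn : 1 ≤ n) {s : ℝ} (hs : 1 / 2 < s)
    (hs1 : s < 1) {ψ : EuclideanSpace ℝ (Fin n) → ℝ} (hψ : Continuous ψ)
    (hc : HasCompactSupport ψ) (hsub : tsupport ψ ⊆ unitBall n) (v : EuclideanSpace ℝ (Fin n)) :
    ∃ C : ℝ, ∀ ε : ℝ, 0 ≤ ε → ∀ x ∈ unitBall n, ∀ y ∈ unitBall n, x ≠ y →
      ‖inner ℝ (greenRegularizedGradient s ε x y) v * ψ x‖ ≤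
        C * ‖x - y‖ ^ (-((n : ℝ) - (2 * s - 1))) := by
  obtain ⟨A, hA, h⟩ := norm_greenRegularizedGradient_le hn hs hs1
  obtain ⟨B, hB, hψB⟩ := abs_le_mul_of_tsupport_subset_unitBall hψ hc hsub s
  refine ⟨A * ‖v‖ * B, fun ε hε x hx y hy hxy => ?_⟩
  have hX := one_sub_norm_pos hx
  have hY := one_sub_norm_pos hy
  have e2 : (1 - ‖y‖) ^ s ≤ 1 :=
    Real.rpow_le_one hY.le (by linarith [norm_nonneg y]) (by linarith)
  have hXs := Real.rpow_pos_of_pos hX s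
  rw [norm_mul, Real.norm_eq_abs (ψ x)]
  calc _ ≤ (A * (((1 - ‖y‖) / (1 - ‖x‖)) ^ s * ‖x - y‖ ^ (-((n : ℝ) - (2 * s - 1)))) * ‖v‖) *
        (B * (1 - ‖x‖) ^ s) := by
        refine mul_le_mul ((norm_inner_le_norm _ _).trans ?_) (hψB x hx) (abs_nonneg _)
          (by positivity)
        gcongr
        exact h s ⟨by linarith, le_rfl⟩ ε hε x hx y hy hxy
    _ = A * ‖v‖ * B * ((1 - ‖y‖) ^ s * ‖x - y‖ ^ (-((n : ℝ) - (2 * s - 1)))) := by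
        rw [Real.div_rpow hY.le hX.le]
        field_simp
    _ ≤ A * ‖v‖ * B * (1 * ‖x - y‖ ^ (-((n : ℝ) - (2 * s - 1)))) := by gcongr
    _ = _ := by rw [one_mul]

lemma integrable_greenRegularized_mul (hn : 1 ≤ n) {s ε : ℝ} (hs : 1 / 2 < s) (hε : 0 ≤ ε)
    {ψ : EuclideanSpace ℝ (Fin n) → ℝ} (hψ : Continuous ψ) (hc : HasCompactSupport ψ)
    (hsub : tsupport ψ ⊆ unitBall n) {y : EuclideanSpace ℝ (Fin n)} (hy : y ∈ unitBall n) :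
    Integrable (fun x => greenRegularized s ε x y * ψ x) (ballVolume n) := by
  obtain ⟨C, hC⟩ := exists_abs_greenRegularized_mul_le hn hs hψ hc hsub
  refine Integrable.mono' ((integrable_norm_sub_rpow_neg hn (b := n - 1) (by linarith) hy).const_mul C)
    ((aestronglyMeasurable_greenRegularized_left (by linarith) hε hy).mul
      hψ.aestronglyMeasurable) ?_
  filter_upwards [ae_ballVolume_mem, ae_ballVolume_ne hn y] with x hx hxy
  exact hC ε hε x hx y hy hxy

lemma integrable_inner_greenRegularizedGradient_mul (hn : 1 ≤ n) {s ε : ℝ} (hs : 1 / 2 < s)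
    (hs1 : s < 1) (hε : 0 ≤ ε) {ψ : EuclideanSpace ℝ (Fin n) → ℝ} (hψ : Continuous ψ)
    (hc : HasCompactSupport ψ) (hsub : tsupport ψ ⊆ unitBall n) (v : EuclideanSpace ℝ (Fin n))
    {y : EuclideanSpace ℝ (Fin n)} (hy : y ∈ unitBall n) :
    Integrable (fun x => inner ℝ (greenRegularizedGradient s ε x y) v * ψ x) (ballVolume n) := by
  obtain ⟨C, hC⟩ := exists_abs_inner_greenRegularizedGradient_mul_le hn hs hs1 hψ hc hsub v
  refine Integrable.mono' ((integrable_norm_sub_rpow_neg hn (b := n - (2 * s - 1)) (by linarith)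
    hy).const_mul C) (((aestronglyMeasurable_greenRegularizedGradient_left (by linarith) hε
      hy).inner aestronglyMeasurable_const).mul hψ.aestronglyMeasurable) ?_
  filter_upwards [ae_ballVolume_mem, ae_ballVolume_ne hn y] with x hx hxy
  exact hC ε hε x hx y hy hxy

lemma integrable_of_integrable_ballVolume {F : EuclideanSpace ℝ (Fin n) → ℝ}
    (hF : Integrable F (ballVolume n)) (h0 : ∀ x ∉ unitBall n, F x = 0) : Integrable F volume := by
  refine (integrableOn_iff_integrable_of_support_subset (s := unitBall n) fun x hx => ?_).1 hF
  by_contra h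
  exact hx (h0 x h)

lemma continuous_fderiv_apply_of_contDiff {φ : EuclideanSpace ℝ (Fin n) → ℝ}
    (hφ : ContDiff ℝ ∞ φ) (v : EuclideanSpace ℝ (Fin n)) :
    Continuous fun x => fderiv ℝ φ x v :=
  (hφ.continuous_fderiv (by simp)).clm_apply continuous_const

/-- For `ε > 0` the kernel is differentiable at `x = y` too, so no diagonal term arises. Integrals
over the ball equal those over the whole space because `φ` is supported inside. -/
lemma integral_greenRegularized_mul_fderiv_of_pos (hn : 1 ≤ n) {s ε : ℝ} (hs : 1 / 2 < s)
    (hs1 : s < 1) (hε : 0 < ε) {φ : EuclideanSpace ℝ (Fin n) → ℝ} (hφ : ContDiff ℝ ∞ φ)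
    (hc : HasCompactSupport φ) (hsub : tsupport φ ⊆ unitBall n) (v : EuclideanSpace ℝ (Fin n))
    {y : EuclideanSpace ℝ (Fin n)} (hy : y ∈ unitBall n) :
    ∫ x, greenRegularized s ε x y * fderiv ℝ φ x v ∂ballVolume n =
      - ∫ x, inner ℝ (greenRegularizedGradient s ε x y) v * φ x ∂ballVolume n := by
  have hgrad : ∀ x ∈ unitBall n, HasGradientAt (fun z => greenRegularized s ε z y)
      (greenRegularizedGradient s ε x y) x := fun x hx =>
    hasGradientAt_greenRegularized (by linarith) hε.le hx hy (Or.inr hε)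
  have hfd : ∀ x ∈ unitBall n, fderiv ℝ (fun z => greenRegularized s ε z y) x v =
      inner ℝ (greenRegularizedGradient s ε x y) v := fun x hx => by
    rw [(hgrad x hx).hasFDerivAt.fderiv, InnerProductSpace.toDual_apply_apply]
  have hφ0 : ∀ x ∉ unitBall n, φ x = 0 := fun x hx =>
    image_eq_zero_of_notMem_tsupport fun h => hx (hsub h)
  have hφ1 : ∀ x ∉ unitBall n, fderiv ℝ φ x v = 0 := fun x hx =>
    image_eq_zero_of_notMem_tsupport (f := fun x => fderiv ℝ φ x v) fun h =>
      hx (hsub (tsupport_fderiv_apply_subset ℝ (f := φ) v h))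
  have hae : (fun x => inner ℝ (greenRegularizedGradient s ε x y) v * φ x) =ᵐ[ballVolume n]
      fun x => fderiv ℝ (fun z => greenRegularized s ε z y) x v * φ x := by
    filter_upwards [ae_ballVolume_mem] with x hx
    rw [hfd x hx]
  have key := integral_mul_fderiv_eq_neg_fderiv_mul_of_integrable (μ := volume)
    (f := fun z => greenRegularized s ε z y) (g := φ) (v := v)
    (integrable_of_integrable_ballVolume
      ((integrable_inner_greenRegularizedGradient_mul hn hs hs1 hε.le hφ.continuous hc hsub v
        hy).congr hae) fun x hx => by rw [hφ0 x hx, mul_zero])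
    (integrable_of_integrable_ballVolume (integrable_greenRegularized_mul hn hs hε.le
      (continuous_fderiv_apply_of_contDiff hφ v) (hc.fderiv_apply ℝ v)
      ((tsupport_fderiv_apply_subset ℝ (f := φ) v).trans hsub) hy) fun x hx => by rw [hφ1 x hx, mul_zero])
    (integrable_of_integrable_ballVolume (integrable_greenRegularized_mul hn hs hε.le
      hφ.continuous hc hsub hy) fun x hx => by rw [hφ0 x hx, mul_zero])
    (fun x hx => (hgrad x (hsub hx)).differentiableAt)
    (fun x _ => (hφ.differentiable (by simp)).differentiableAt)
  rw [integral_congr_ae hae, setIntegral_eq_integral_of_forall_compl_eq_zero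
      (fun x hx => by rw [hφ1 x hx, mul_zero]), key,
    setIntegral_eq_integral_of_forall_compl_eq_zero (fun x hx => by rw [hφ0 x hx, mul_zero])]

/-- Dominated convergence along `ε = 1/(k+1)`; the majorant `|x-y|^(-(n-(2s-1)))` of the gradient is
integrable because `s > 1/2`. -/
lemma integral_greenRegularized_zero_mul_fderiv (hn : 1 ≤ n) {s : ℝ} (hs : 1 / 2 < s)
    (hs1 : s < 1) {φ : EuclideanSpace ℝ (Fin n) → ℝ} (hφ : ContDiff ℝ ∞ φ)
    (hc : HasCompactSupport φ) (hsub : tsupport φ ⊆ unitBall n) (v : EuclideanSpace ℝ (Fin n))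
    {y : EuclideanSpace ℝ (Fin n)} (hy : y ∈ unitBall n) :
    ∫ x, greenRegularized s 0 x y * fderiv ℝ φ x v ∂ballVolume n =
      - ∫ x, inner ℝ (greenRegularizedGradient s 0 x y) v * φ x ∂ballVolume n := by
  have hε : ∀ k : ℕ, (0 : ℝ) < 1 / ((k : ℝ) + 1) := fun k => by positivity
  have hlim : Tendsto (fun k : ℕ => 1 / ((k : ℝ) + 1)) atTop (𝓝 0) :=
    tendsto_one_div_add_atTop_nhds_zero_nat
  have hψ := continuous_fderiv_apply_of_contDiff hφ v
  have hψc := hc.fderiv_apply ℝ v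
  have hψs := (tsupport_fderiv_apply_subset ℝ (f := φ) v).trans hsub
  obtain ⟨A, hA⟩ := exists_abs_greenRegularized_mul_le hn hs hψ hψc hψs
  obtain ⟨B, hB⟩ := exists_abs_inner_greenRegularizedGradient_mul_le hn hs hs1 hφ.continuous hc
    hsub v
  have t1 : Tendsto (fun k : ℕ => ∫ x, greenRegularized s (1 / ((k : ℝ) + 1)) x y *
      fderiv ℝ φ x v ∂ballVolume n) atTop
      (𝓝 (∫ x, greenRegularized s 0 x y * fderiv ℝ φ x v ∂ballVolume n)) := by
    refine tendsto_integral_of_dominated_convergence _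
      (fun k => (integrable_greenRegularized_mul hn hs (hε k).le hψ hψc hψs hy).aestronglyMeasurable)
      ((integrable_norm_sub_rpow_neg hn (b := n - 1) (by linarith) hy).const_mul A) ?_ ?_
    · intro k
      filter_upwards [ae_ballVolume_mem, ae_ballVolume_ne hn y] with x hx hxy
      exact hA _ (hε k).le x hx y hy hxy
    · filter_upwards [ae_ballVolume_mem, ae_ballVolume_ne hn y] with x hx hxy
      exact ((tendsto_greenRegularized (by linarith) hx hy hxy).comp hlim).mul_const _
  have t2 : Tendsto (fun k : ℕ => ∫ x, inner ℝ (greenRegularizedGradient s (1 / ((k : ℝ) + 1)) x y) v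
      * φ x ∂ballVolume n) atTop
      (𝓝 (∫ x, inner ℝ (greenRegularizedGradient s 0 x y) v * φ x ∂ballVolume n)) := by
    refine tendsto_integral_of_dominated_convergence _
      (fun k => (integrable_inner_greenRegularizedGradient_mul hn hs hs1 (hε k).le hφ.continuous
        hc hsub v hy).aestronglyMeasurable)
      ((integrable_norm_sub_rpow_neg hn (b := n - (2 * s - 1)) (by linarith) hy).const_mul B) ?_ ?_
    · intro k
      filter_upwards [ae_ballVolume_mem, ae_ballVolume_ne hn y] with x hx hxy
      exact hB _ (hε k).le x hx y hy hxy
    · filter_upwards [ae_ballVolume_mem, ae_ballVolume_ne hn y] with x hx hxy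
      exact ((((tendsto_greenRegularizedGradient (by linarith) hx hy hxy).comp hlim).inner
        tendsto_const_nhds).mul_const _)
  refine tendsto_nhds_unique t1 (t2.neg.congr fun k => ?_)
  exact (integral_greenRegularized_mul_fderiv_of_pos hn hs hs1 (hε k) hφ hc hsub v hy).symm

/-- The potential of `f` with kernel `∇ₓ G(x, y)`. -/
noncomputable def greenGradientPotential (s : ℝ) (f : EuclideanSpace ℝ (Fin n) → ℝ)
    (x : EuclideanSpace ℝ (Fin n)) : EuclideanSpace ℝ (Fin n) :=
  ∫ y, f y • greenRegularizedGradient s 0 x y ∂ballVolume n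

lemma greenPotential_eq {s : ℝ} (f : EuclideanSpace ℝ (Fin n) → ℝ)
    {x : EuclideanSpace ℝ (Fin n)} (hx : x ∈ unitBall n) :
    greenPotential s f x = ∫ y, f y * greenRegularized s 0 x y ∂ballVolume n := by
  simp only [greenPotential, if_pos hx, greenFunction_eq_greenRegularized]

lemma integrable_prod_mul_of_weighted {t : ℝ}
    {F : EuclideanSpace ℝ (Fin n) × EuclideanSpace ℝ (Fin n) → ℝ}
    (hF : Integrable (fun z => (1 - ‖z.1‖) ^ t * F z) ((ballVolume n).prod (ballVolume n)))
    {ψ : EuclideanSpace ℝ (Fin n) → ℝ}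
    (hψ : Continuous ψ) (hc : HasCompactSupport ψ) (hsub : tsupport ψ ⊆ unitBall n) :
    Integrable (fun z => F z * ψ z.1) ((ballVolume n).prod (ballVolume n)) := by
  obtain ⟨C, hC0, hC⟩ := abs_le_mul_of_tsupport_subset_unitBall hψ hc hsub t
  have hFm : AEStronglyMeasurable F ((ballVolume n).prod (ballVolume n)) := by
    have h1 := ((by fun_prop : Measurable fun z : EuclideanSpace ℝ (Fin n) ×
      EuclideanSpace ℝ (Fin n) => (1 - ‖z.1‖) ^ (-t)).aestronglyMeasurable
      (μ := (ballVolume n).prod (ballVolume n))).mul hF.aestronglyMeasurable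
    refine h1.congr ?_
    filter_upwards [ae_ballVolume_prod_mem] with z hz
    have hX := one_sub_norm_pos hz.1
    simp only [Pi.mul_apply]
    rw [← mul_assoc, ← Real.rpow_add hX]
    simp
  refine (hF.const_mul C).mono (hFm.mul (hψ.comp continuous_fst).aestronglyMeasurable) ?_
  filter_upwards [ae_ballVolume_prod_mem] with z hz
  have hX := Real.rpow_pos_of_pos (one_sub_norm_pos hz.1) t
  rw [norm_mul, norm_mul, norm_mul, Real.norm_of_nonneg hC0, Real.norm_of_nonneg hX.le,
    Real.norm_eq_abs (ψ z.1)]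
  calc ‖F z‖ * |ψ z.1| ≤ ‖F z‖ * (C * (1 - ‖z.1‖) ^ t) := by
        gcongr
        exact hC _ hz.1
    _ = _ := by ring

lemma integrable_of_weighted_smul {F : Type*} [NormedAddCommGroup F] [NormedSpace ℝ F]
    {t : ℝ} {x : EuclideanSpace ℝ (Fin n)} (hx : x ∈ unitBall n)
    {h : EuclideanSpace ℝ (Fin n) → F}
    (hh : Integrable (fun y => (1 - ‖x‖) ^ t • h y) (ballVolume n)) :
    Integrable h (ballVolume n) :=
  (integrable_fun_smul_iff (Real.rpow_pos_of_pos (one_sub_norm_pos hx) t).ne' h).1 hh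

lemma integral_greenPotential_mul_fderiv (hn : 1 ≤ n) {s r : ℝ} (hs : 1 / 2 < s)
    (hs1 : s < 1) (hr : r ∈ Icc (1 - s) s) {f : EuclideanSpace ℝ (Fin n) → ℝ}
    (hf : Integrable (fun y => (1 - ‖y‖) ^ r * f y) (ballVolume n))
    {φ : EuclideanSpace ℝ (Fin n) → ℝ} (hφ : ContDiff ℝ ∞ φ)
    (hc : HasCompactSupport φ) (hsub : tsupport φ ⊆ unitBall n) (v : EuclideanSpace ℝ (Fin n)) :
    ∫ x, greenPotential s f x * fderiv ℝ φ x v ∂ballVolume n =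
      - ∫ x, inner ℝ (greenGradientPotential s f x) v * φ x ∂ballVolume n := by
  have hψ := continuous_fderiv_apply_of_contDiff hφ v
  have hψc := hc.fderiv_apply ℝ v
  have hψs := (tsupport_fderiv_apply_subset ℝ (f := φ) v).trans hsub
  have hG := integrable_weighted_greenRegularized hn hs hr.2 hf
  have hD := integrable_weighted_greenRegularizedGradient hn hs hs1 hr hf
  have hI1 := integrable_prod_mul_of_weighted hG hψ hψc hψs
  have hDv : Integrable (fun z : EuclideanSpace ℝ (Fin n) × EuclideanSpace ℝ (Fin n) =>
      (1 - ‖z.1‖) ^ r * (f z.2 * inner ℝ (greenRegularizedGradient s 0 z.1 z.2) v))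
      ((ballVolume n).prod (ballVolume n)) := by
    refine (hD.inner_const v).congr (Eventually.of_forall fun z => ?_)
    simp only [real_inner_smul_left]
  have hI2 := integrable_prod_mul_of_weighted hDv hφ.continuous hc hsub
  calc ∫ x, greenPotential s f x * fderiv ℝ φ x v ∂ballVolume n
      = ∫ x, ∫ y, f y * greenRegularized s 0 x y * fderiv ℝ φ x v ∂ballVolume n ∂ballVolume n := by
        refine integral_congr_ae ?_
        filter_upwards [ae_ballVolume_mem] with x hx
        rw [greenPotential_eq f hx, integral_mul_const]
    _ = ∫ y, ∫ x, f y * greenRegularized s 0 x y * fderiv ℝ φ x v ∂ballVolume n ∂ballVolume n :=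
        integral_integral_swap hI1
    _ = ∫ y, -∫ x, f y * inner ℝ (greenRegularizedGradient s 0 x y) v * φ x
          ∂ballVolume n ∂ballVolume n := by
        refine integral_congr_ae ?_
        filter_upwards [ae_ballVolume_mem] with y hy
        simp_rw [mul_assoc]
        rw [integral_const_mul, integral_const_mul,
          integral_greenRegularized_zero_mul_fderiv hn hs hs1 hφ hc hsub v hy, mul_neg]
    _ = -∫ x, ∫ y, f y * inner ℝ (greenRegularizedGradient s 0 x y) v * φ x
          ∂ballVolume n ∂ballVolume n := by
        rw [integral_neg]
        exact congrArg Neg.neg (integral_integral_swap hI2).symm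
    _ = _ := by
        congr 1
        refine integral_congr_ae ?_
        -- Taking the inner product under the integral requires an integrable section in `y`,
        -- available for almost every `x`.
        filter_upwards [ae_ballVolume_mem, hD.prod_right_ae] with x hx hDx
        have hI := integrable_of_weighted_smul hx hDx
        rw [integral_mul_const, greenGradientPotential, real_inner_comm, ← integral_inner hI v]
        congr 1
        refine integral_congr_ae (Eventually.of_forall fun y => ?_)
        simp only [real_inner_smul_right, real_inner_comm]

lemma hasWeakGradientOn_greenPotential (hn : 1 ≤ n) {s r : ℝ} (hs : 1 / 2 < s)
    (hs1 : s < 1) (hr : r ∈ Icc (1 - s) s) {f : EuclideanSpace ℝ (Fin n) → ℝ}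
    (hf : Integrable (fun y => (1 - ‖y‖) ^ r * f y) (ballVolume n)) :
    HasWeakGradientOn (unitBall n) (greenPotential s f) (greenGradientPotential s f) := by
  refine ⟨locallyIntegrableOn_unitBall_of_weighted (t := 1 - s) ?_,
    locallyIntegrableOn_unitBall_of_weighted (t := r) ?_,
    fun φ hφ hc hsub v => integral_greenPotential_mul_fderiv hn hs hs1 hr hf hφ hc hsub v⟩
  · refine (integrable_weighted_greenRegularized hn hs hr.2 hf).integral_prod_left.congr ?_
    filter_upwards [ae_ballVolume_mem] with x hx
    rw [greenPotential_eq f hx, integral_const_mul, smul_eq_mul]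
  · refine (integrable_weighted_greenRegularizedGradient hn hs hs1 hr
      hf).integral_prod_left.congr (Eventually.of_forall fun x => ?_)
    simp only [greenGradientPotential, integral_smul]

end WeakGradient

/-! ### Weighted norms on the ball -/

section WeightedNorms

open Filter Topology

variable {n : ℕ}

lemma infDist_compl_unitBall (hn : 1 ≤ n) {x : EuclideanSpace ℝ (Fin n)} (hx : x ∈ unitBall n) :
    infDist x (unitBall n)ᶜ = 1 - ‖x‖ := by
  have := nontrivial_euclideanSpace_fin hn
  have hmem : ∀ y : EuclideanSpace ℝ (Fin n), y ∈ (unitBall n)ᶜ ↔ 1 ≤ ‖y‖ := fun y => by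
    rw [mem_compl_iff, mem_unitBall, not_lt]
  -- The point `e` of the sphere is nearest to `x`; for `x = 0` any unit vector works, and one
  -- exists because `n ≥ 1`.
  obtain ⟨e, he, hxe⟩ : ∃ e : EuclideanSpace ℝ (Fin n), ‖e‖ = 1 ∧ x = ‖x‖ • e := by
    rcases eq_or_ne x 0 with rfl | hx0
    · obtain ⟨e, he⟩ := exists_norm_eq (EuclideanSpace ℝ (Fin n)) zero_le_one
      exact ⟨e, he, by simp⟩
    · refine ⟨‖x‖⁻¹ • x, norm_smul_inv_norm hx0, ?_⟩
      rw [smul_smul, mul_inv_cancel₀ (norm_ne_zero_iff.2 hx0), one_smul]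
  apply le_antisymm
  · refine (infDist_le_dist_of_mem ((hmem e).2 he.ge)).trans (le_of_eq ?_)
    have h1 : e - x = (1 - ‖x‖) • e := by
      rw [sub_smul, one_smul, ← hxe]
    rw [dist_comm, dist_eq_norm, h1, norm_smul, he, mul_one,
      Real.norm_of_nonneg (one_sub_norm_pos hx).le]
  · rw [le_infDist ⟨e, (hmem e).2 he.ge⟩]
    intro y hy
    have h2 := (hmem y).1 hy
    have h3 := norm_sub_norm_le y x
    rw [dist_comm, dist_eq_norm]
    linarith

lemma weightedNorm_unitBall (hn : 1 ≤ n) (p : ℝ≥0∞) (r : ℝ)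
    (f : EuclideanSpace ℝ (Fin n) → ℝ) :
    weightedNorm (unitBall n) p r f =
      eLpNorm (fun x => (1 - ‖x‖) ^ r * f x) p (ballVolume n) := by
  refine eLpNorm_congr_ae ?_
  filter_upwards [ae_ballVolume_mem] with x hx
  rw [infDist_compl_unitBall hn hx]

lemma MemWeightedLp.aestronglyMeasurable_weighted {p : ℝ≥0∞} {r : ℝ}
    {f : EuclideanSpace ℝ (Fin n) → ℝ} (hf : MemWeightedLp (unitBall n) p r f) :
    AEStronglyMeasurable (fun y => (1 - ‖y‖) ^ r * f y) (ballVolume n) :=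
  (by fun_prop : Measurable fun y : EuclideanSpace ℝ (Fin n) =>
    (1 - ‖y‖) ^ r).aestronglyMeasurable.mul hf.1.aestronglyMeasurable

/-- The ball has finite measure, so the weak gradient has to be constructed only for `δ^r f ∈ L¹`.
-/
lemma MemWeightedLp.integrable_weighted (hn : 1 ≤ n) {p : ℝ≥0∞} (hp : 1 ≤ p) {r : ℝ}
    {f : EuclideanSpace ℝ (Fin n) → ℝ} (hf : MemWeightedLp (unitBall n) p r f) :
    Integrable (fun y => (1 - ‖y‖) ^ r * f y) (ballVolume n) :=
  MemLp.integrable hp ⟨hf.aestronglyMeasurable_weighted, by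
    rw [← weightedNorm_unitBall hn]; exact hf.2⟩

/-- The weights in the kernel bound are carried by `f` and by the gradient, leaving an unweighted
Riesz kernel. -/
lemma enorm_weighted_greenGradientPotential_le (hn : 1 ≤ n) {s : ℝ} (hs : 1 / 2 < s)
    (hs1 : s < 1) :
    ∃ C : ℝ, 0 < C ∧ ∀ r ∈ Icc (1 - s) s, ∀ f : EuclideanSpace ℝ (Fin n) → ℝ,
      ∀ x ∈ unitBall n, ‖(1 - ‖x‖) ^ r * ‖greenGradientPotential s f x‖‖ₑ ≤
        ENNReal.ofReal C * rieszPotential (ballVolume n) (n - (2 * s - 1))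
          (fun y => ‖(1 - ‖y‖) ^ r * f y‖ₑ) x := by
  obtain ⟨C, hC, h⟩ := norm_greenRegularizedGradient_le hn hs hs1
  refine ⟨C, hC, fun r hr f x hx => ?_⟩
  have hX := one_sub_norm_pos hx
  have hXr := Real.rpow_pos_of_pos hX r
  rw [enorm_mul, enorm_norm, rieszPotential, ← lintegral_const_mul' _ _ ENNReal.ofReal_ne_top]
  refine (mul_le_mul_right (enorm_integral_le_lintegral_enorm _) _).trans ?_
  rw [← lintegral_const_mul' _ _ (by finiteness)]
  refine lintegral_mono_ae ?_
  filter_upwards [ae_ballVolume_mem, ae_ballVolume_ne hn x] with y hy hyx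
  have hY := one_sub_norm_pos hy
  have hYr := Real.rpow_pos_of_pos hY r
  have h1 := h r hr 0 le_rfl x hx y hy hyx.symm
  rw [← ofReal_norm, ← ofReal_norm, ← ofReal_norm, ← ENNReal.ofReal_mul (by positivity),
    ← ENNReal.ofReal_mul (by positivity), ← ENNReal.ofReal_mul (by positivity)]
  refine ENNReal.ofReal_le_ofReal ?_
  rw [norm_smul, norm_mul, Real.norm_of_nonneg hXr.le, Real.norm_of_nonneg hYr.le]
  calc _ ≤ (1 - ‖x‖) ^ r * (‖f y‖ * (C * (((1 - ‖y‖) / (1 - ‖x‖)) ^ r *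
        ‖x - y‖ ^ (-((n : ℝ) - (2 * s - 1)))))) := by gcongr
    _ = _ := by
        rw [Real.div_rpow hY.le hX.le]
        field_simp

/-- This reduces each of the three cases to an `L^p` to `L^q` bound for the Riesz potential on the
ball. -/
lemma exists_weakGradient_of_rieszPotential_bound (hn : 1 ≤ n) {s : ℝ} (hs : 1 / 2 < s)
    (hs1 : s < 1) {p q : ℝ≥0∞} (hp : 1 ≤ p) {K : ℝ≥0∞} (hK : K ≠ ⊤)
    (hbound : ∀ h : EuclideanSpace ℝ (Fin n) → ℝ≥0∞, Measurable h →
      eLpNorm (rieszPotential (ballVolume n) (n - (2 * s - 1)) h) q (ballVolume n) ≤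
        K * eLpNorm h p (ballVolume n)) :
    ∃ C : ℝ≥0, 0 < C ∧ ∀ r ∈ Icc (1 - s) s, ∀ f : EuclideanSpace ℝ (Fin n) → ℝ,
      MemWeightedLp (unitBall n) p r f →
        ∃ g : EuclideanSpace ℝ (Fin n) → EuclideanSpace ℝ (Fin n),
          HasWeakGradientOn (unitBall n) (greenPotential s f) g ∧
          MemWeightedLp (unitBall n) q r (fun x => ‖g x‖) ∧
          weightedNorm (unitBall n) q r (fun x => ‖g x‖) ≤ C * weightedNorm (unitBall n) p r f := by
  obtain ⟨A, hA, hpt⟩ := enorm_weighted_greenGradientPotential_le hn hs hs1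
  refine ⟨A.toNNReal * K.toNNReal + 1, by positivity, fun r hr f hf => ?_⟩
  have hweak := hasWeakGradientOn_greenPotential hn hs hs1 hr (hf.integrable_weighted hn hp)
  have hle : weightedNorm (unitBall n) q r (fun x => ‖greenGradientPotential s f x‖) ≤
      ((A.toNNReal * K.toNNReal + 1 : ℝ≥0) : ℝ≥0∞) * weightedNorm (unitBall n) p r f := by
    -- The bound `hbound` asks for a measurable function; passing to a measurable representative
    -- changes neither the potential nor the norm.
    have hm : AEMeasurable (fun y => ‖(1 - ‖y‖) ^ r * f y‖ₑ) (ballVolume n) :=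
      hf.aestronglyMeasurable_weighted.enorm
    have hcongr : ∀ x, rieszPotential (ballVolume n) (n - (2 * s - 1))
        (fun y => ‖(1 - ‖y‖) ^ r * f y‖ₑ) x =
        rieszPotential (ballVolume n) (n - (2 * s - 1)) (hm.mk _) x := fun x => by
      refine lintegral_congr_ae ?_
      filter_upwards [hm.ae_eq_mk] with y hy
      rw [← hy]
    have hnorm : eLpNorm (hm.mk _) p (ballVolume n) =
        eLpNorm (fun y => (1 - ‖y‖) ^ r * f y) p (ballVolume n) := by
      refine eLpNorm_congr_enorm_ae ?_
      filter_upwards [hm.ae_eq_mk] with y hy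
      rw [enorm_eq_self, ← hy]
    rw [weightedNorm_unitBall hn, weightedNorm_unitBall hn]
    calc _ ≤ A.toNNReal • eLpNorm (rieszPotential (ballVolume n) (n - (2 * s - 1)) (hm.mk _)) q
          (ballVolume n) := by
          refine eLpNorm_le_nnreal_smul_eLpNorm_of_ae_le_mul' ?_ q
          filter_upwards [ae_ballVolume_mem] with x hx
          rw [enorm_eq_self, ← hcongr]
          exact hpt r hr f x hx
      _ ≤ A.toNNReal * (K * eLpNorm (hm.mk _) p (ballVolume n)) := by
          rw [ENNReal.smul_def, smul_eq_mul]
          gcongr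
          exact hbound _ hm.measurable_mk
      _ = ((A.toNNReal * K.toNNReal : ℝ≥0) : ℝ≥0∞) *
          eLpNorm (fun y => (1 - ‖y‖) ^ r * f y) p (ballVolume n) := by
          rw [hnorm, ENNReal.coe_mul, ENNReal.coe_toNNReal hK, mul_assoc]
      _ ≤ _ := by
          gcongr
          exact le_self_add
  exact ⟨greenGradientPotential s f, hweak, ⟨hweak.2.1.norm,
    hle.trans_lt (ENNReal.mul_lt_top ENNReal.coe_lt_top hf.2)⟩, hle⟩

/-! ### Riesz potential bounds as `eLpNorm` inequalities on the ball -/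

lemma eLpNorm_ofReal_eq {α : Type*} [MeasurableSpace α] {μ : Measure α} {p : ℝ} (hp : 0 < p)
    (h : α → ℝ≥0∞) : eLpNorm h (ENNReal.ofReal p) μ = (∫⁻ x, h x ^ p ∂μ) ^ (1 / p) := by
  rw [eLpNorm_eq_lintegral_rpow_enorm_toReal (by simpa using hp) ENNReal.ofReal_ne_top,
    ENNReal.toReal_ofReal hp.le]
  simp only [enorm_eq_self]

lemma eLpNorm_rieszPotential_le_of_one (hn : 1 ≤ n) {b q : ℝ} (hq : 1 ≤ q) (hbq : b * q < n) :
    ∃ K : ℝ≥0∞, K ≠ ⊤ ∧ ∀ h : EuclideanSpace ℝ (Fin n) → ℝ≥0∞, Measurable h →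
      eLpNorm (rieszPotential (ballVolume n) b h) (ENNReal.ofReal q) (ballVolume n) ≤
        K * eLpNorm h 1 (ballVolume n) := by
  have := nontrivial_euclideanSpace_fin hn
  obtain ⟨K, hK, hle⟩ := lintegral_rieszPotential_ball_rpow_le
    (volume : Measure (EuclideanSpace ℝ (Fin n))) hq (by simpa using hbq)
  refine ⟨K, hK, fun h hh => ?_⟩
  rw [eLpNorm_ofReal_eq (by linarith), eLpNorm_one_eq_lintegral_enorm]
  simp only [enorm_eq_self]
  exact hle h hh

lemma eLpNorm_rieszPotential_le_of_lt (hn : 1 ≤ n) {a p : ℝ} (ha : 0 < a) (hp : 1 < p)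
    (hap : a * p < n) :
    ∃ K : ℝ≥0∞, K ≠ ⊤ ∧ ∀ h : EuclideanSpace ℝ (Fin n) → ℝ≥0∞, Measurable h →
      eLpNorm (rieszPotential (ballVolume n) (n - a) h)
        (ENNReal.ofReal (n * p / (n - a * p))) (ballVolume n) ≤
        K * eLpNorm h (ENNReal.ofReal p) (ballVolume n) := by
  have := nontrivial_euclideanSpace_fin hn
  obtain ⟨K, hK, hle⟩ := lintegral_rieszPotential_rpow_le
    (volume : Measure (EuclideanSpace ℝ (Fin n))) ha hp (by simpa using hap)
  rw [finrank_euclideanSpace_fin] at hle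
  have hn' : (1 : ℝ) ≤ n := by exact_mod_cast hn
  have hnap : 0 < n - a * p := by linarith
  have hq : 0 < n * p / (n - a * p) := by positivity
  have hp0 : 0 < p := by linarith
  refine ⟨K, hK, fun h hh => ?_⟩
  rw [eLpNorm_ofReal_eq hq, eLpNorm_ofReal_eq hp0]
  -- Extension by zero reduces the ball to Hardy-Littlewood-Sobolev on the whole space.
  have h1 : rieszPotential (ballVolume n) (n - a) h =
      rieszPotential volume (n - a) ((unitBall n).indicator h) := by
    ext x
    rw [rieszPotential, rieszPotential, ← lintegral_indicator measurableSet_unitBall]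
    refine lintegral_congr fun y => ?_
    simp only [indicator]
    split_ifs <;> simp
  have h2 : ∫⁻ x, h x ^ p ∂ballVolume n = ∫⁻ x, (unitBall n).indicator h x ^ p := by
    rw [← lintegral_indicator measurableSet_unitBall]
    refine lintegral_congr fun y => ?_
    simp only [indicator]
    split_ifs <;> simp [hp0]
  rw [h1, h2]
  refine le_trans ?_ (hle _ (hh.indicator measurableSet_unitBall))
  gcongr
  exact Measure.restrict_le_self

lemma eLpNorm_top_rieszPotential_le (hn : 1 ≤ n) {a : ℝ} (ha : 0 < a) {p : ℝ≥0∞} (hp : 1 < p)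
    (hap : ENNReal.ofReal (n / a) < p) :
    ∃ K : ℝ≥0∞, K ≠ ⊤ ∧ ∀ h : EuclideanSpace ℝ (Fin n) → ℝ≥0∞, Measurable h →
      eLpNorm (rieszPotential (ballVolume n) (n - a) h) ⊤ (ballVolume n) ≤
        K * eLpNorm h p (ballVolume n) := by
  have := nontrivial_euclideanSpace_fin hn
  have hess : ∀ (u : EuclideanSpace ℝ (Fin n) → ℝ≥0∞) (c : ℝ≥0∞), (∀ x ∈ unitBall n, u x ≤ c) →
      eLpNorm u ⊤ (ballVolume n) ≤ c := by
    intro u c hu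
    rw [eLpNorm_exponent_top]
    refine essSup_le_of_ae_le c ?_
    filter_upwards [ae_ballVolume_mem] with x hx
    rw [enorm_eq_self]
    exact hu x hx
  by_cases hpt : p = ⊤
  · subst hpt
    obtain ⟨K, hK, hle⟩ := rieszPotential_ball_le_essSup
      (volume : Measure (EuclideanSpace ℝ (Fin n))) (b := n - a)
      (by rw [finrank_euclideanSpace_fin]; linarith)
    refine ⟨K, hK, fun h hh => hess _ _ fun x hx => ?_⟩
    rw [eLpNorm_exponent_top, eLpNormEssSup_eq_essSup_enorm]
    simp only [enorm_eq_self]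
    exact hle h hh x hx
  · have hp1 : 1 < p.toReal := by
      rw [← ENNReal.toReal_one]
      exact ENNReal.toReal_strict_mono hpt hp
    have hap' : n < a * p.toReal := by
      rw [ENNReal.ofReal_lt_iff_lt_toReal (by positivity) hpt, div_lt_iff₀ ha] at hap
      linarith
    obtain ⟨K, hK, hle⟩ := rieszPotential_ball_le_rpow
      (volume : Measure (EuclideanSpace ℝ (Fin n))) hp1 (a := a)
      (by rw [finrank_euclideanSpace_fin]; exact hap')
    rw [finrank_euclideanSpace_fin] at hle
    refine ⟨K, hK, fun h hh => hess _ _ fun x hx => ?_⟩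
    rw [← ENNReal.ofReal_toReal hpt, eLpNorm_ofReal_eq (by linarith)]
    exact hle h hh x hx

end WeightedNorms

theorem mainTheorem4 (n : ℕ) (hn : 1 ≤ n) (s : ℝ) (hs : 1 / 2 < s) (hs1 : s < 1) :
    -- the pointwise bound for the gradient of Green's function
    (∃ C : ℝ, 0 < C ∧ ∀ r ∈ Icc (1 - s) s,
      ∀ x ∈ unitBall n, ∀ y ∈ unitBall n, x ≠ y →
        DifferentiableAt ℝ (fun z => greenFunction s z y) x ∧
        ‖gradient (fun z => greenFunction s z y) x‖ * (1 - ‖x‖) ^ r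
          ≤ C * (1 - ‖y‖) ^ r / ‖x - y‖ ^ ((n : ℝ) - 2 * s + 1)) ∧
    -- the Green potential is given by a convergent integral almost everywhere
    (∀ r ∈ Icc (1 - s) s, ∀ p : ℝ≥0∞, 1 ≤ p → ∀ f : EuclideanSpace ℝ (Fin n) → ℝ,
      MemWeightedLp (unitBall n) p r f →
        ∀ᵐ x ∂volume.restrict (unitBall n),
          IntegrableOn (fun y => f y * greenFunction s x y) (unitBall n) volume) ∧
    -- the case p = 1
    (∀ q : ℝ, 1 ≤ q → q < n / (n - 2 * s + 1) →
      ∃ C : ℝ≥0, 0 < C ∧ ∀ r ∈ Icc (1 - s) s, ∀ f : EuclideanSpace ℝ (Fin n) → ℝ,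
        MemWeightedLp (unitBall n) 1 r f →
          ∃ g : EuclideanSpace ℝ (Fin n) → EuclideanSpace ℝ (Fin n),
            HasWeakGradientOn (unitBall n) (greenPotential s f) g ∧
            MemWeightedLp (unitBall n) (ENNReal.ofReal q) r (fun x => ‖g x‖) ∧
            weightedNorm (unitBall n) (ENNReal.ofReal q) r (fun x => ‖g x‖)
              ≤ C * weightedNorm (unitBall n) 1 r f) ∧
    -- the case 1 < p < n / (2s - 1)
    (∀ p : ℝ, 1 < p → p < n / (2 * s - 1) →
      ∃ C : ℝ≥0, 0 < C ∧ ∀ r ∈ Icc (1 - s) s, ∀ f : EuclideanSpace ℝ (Fin n) → ℝ,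
        MemWeightedLp (unitBall n) (ENNReal.ofReal p) r f →
          ∃ g : EuclideanSpace ℝ (Fin n) → EuclideanSpace ℝ (Fin n),
            HasWeakGradientOn (unitBall n) (greenPotential s f) g ∧
            MemWeightedLp (unitBall n)
              (ENNReal.ofReal (n * p / (n - (2 * s - 1) * p))) r (fun x => ‖g x‖) ∧
            weightedNorm (unitBall n)
              (ENNReal.ofReal (n * p / (n - (2 * s - 1) * p))) r (fun x => ‖g x‖)
              ≤ C * weightedNorm (unitBall n) (ENNReal.ofReal p) r f) ∧
    -- the case n / (2s - 1) < p ≤ ∞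
    (∀ p : ℝ≥0∞, ENNReal.ofReal (n / (2 * s - 1)) < p →
      ∃ C : ℝ≥0, 0 < C ∧ ∀ r ∈ Icc (1 - s) s, ∀ f : EuclideanSpace ℝ (Fin n) → ℝ,
        MemWeightedLp (unitBall n) p r f →
          ∃ g : EuclideanSpace ℝ (Fin n) → EuclideanSpace ℝ (Fin n),
            HasWeakGradientOn (unitBall n) (greenPotential s f) g ∧
            MemWeightedLp (unitBall n) ⊤ r (fun x => ‖g x‖) ∧
            weightedNorm (unitBall n) ⊤ r (fun x => ‖g x‖)
              ≤ C * weightedNorm (unitBall n) p r f) := by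
  have ha : 0 < 2 * s - 1 := by linarith
  have hn' : (1 : ℝ) ≤ n := by exact_mod_cast hn
  refine ⟨norm_gradient_greenFunction_le hn hs hs1, ?_, ?_, ?_, ?_⟩
  · intro r hr p hp f hf
    have h := integrable_weighted_greenRegularized hn hs hr.2 (hf.integrable_weighted hn hp)
    filter_upwards [ae_ballVolume_mem, h.prod_right_ae] with x hx hxI
    simp_rw [greenFunction_eq_greenRegularized]
    exact integrable_of_weighted_smul hx hxI
  · intro q hq hqn
    have hb : 0 < (n : ℝ) - 2 * s + 1 := by linarith
    rw [lt_div_iff₀ hb] at hqn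
    obtain ⟨K, hK, hle⟩ := eLpNorm_rieszPotential_le_of_one hn (b := n - (2 * s - 1)) hq
      (by linarith)
    exact exists_weakGradient_of_rieszPotential_bound hn hs hs1 le_rfl hK hle
  · intro p hp hpn
    rw [lt_div_iff₀ ha] at hpn
    obtain ⟨K, hK, hle⟩ := eLpNorm_rieszPotential_le_of_lt hn ha hp (by linarith)
    exact exists_weakGradient_of_rieszPotential_bound hn hs hs1
      (by simpa using hp.le) hK hle
  · intro p hp
    -- The threshold `n/(2s-1)` is at least 1 because `2s-1 < 1 ≤ n`.
    have h1 : 1 < p := by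
      refine lt_of_le_of_lt ?_ hp
      rw [ENNReal.one_le_ofReal, le_div_iff₀ ha]
      linarith
    obtain ⟨K, hK, hle⟩ := eLpNorm_top_rieszPotential_le hn ha h1 hp
    exact exists_weakGradient_of_rieszPotential_bound hn hs hs1 h1.le hK hle
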